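/- Let $n\ge 0$, let $\nu=E^{\nu_0}NE^{\nu_1}\cdots NE^{\nu_n}$ with $\nu_i\in\mathbb Z_{\ge0}$ be a finite northeast lattice path, and let $\delta=(\delta_1,\dots,\delta_n)$ be an increment vector, that is, $\delta_i\in\mathbb Z$ with $0\le\delta_i\le\nu_i$ for $1\le i\le n$. Then the canonical join complex of the alt $\nu$-Tamari lattice $\mathrm{Tam}_\nu(\delta)$ exists and is (non-pure) vertex decomposable. More precisely, $\mathrm{Tam}_\nu(\delta)$ is a finite lattice, every element of it has a canonical join representation, and the simplicial complex formed by these canonical join representations is vertex decomposable. Here the notions are as follows. *The alt $\nu$-Tamari lattice.* Put $\check\nu_0=\sum_{i=0}^n\nu_i-\sum_{i=1}^n\delta_i$. Let $\check\nu=E^{\check\nu_0}NE^{\delta_1}\cdots NE^{\delta_n}$ be the northeast path starting at $(0,0)$, let $F_{\check\nu}$ be the region weakly above $\check\nu$ in its bounding rectangle, and let $\hat\nu=W^{\nu_0}NW^{\nu_1-\delta_1}\cdots NW^{\nu_n-\delta_n}$ be the northwest path starting at $(\check\nu_0,0)$. Let $L_{\delta,\nu}$ be the set of lattice points of $F_{\check\nu}$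 weakly above $\hat\nu$. Two points of $L_{\delta,\nu}$ are incompatible if one is strictly southwest of the other and the smallest axis-parallel rectangle containing both lies in $F_{\check\nu}$; otherwise they are compatible. A $(\delta,\nu)$-tree is a maximal set of pairwise compatible points of $L_{\delta,\nu}$. A tree $T'$ arises from a tree $T$ by a right rotation if there are $x<x'$ and $y<y'$ such that $(x,y'),(x,y),(x',y)$ are the only points of $T$ in $[x,x']\times[y,y']$ and $T'=(T\setminus\{(x,y)\})\cup\{(x',y')\}$. $\mathrm{Tam}_\nu(\delta)$ is the set of $(\delta,\nu)$-trees, ordered by the reflexive and transitive closure of right rotation. *Canonical join complex.* An element of a finite lattice $L$ is join-irreducible if it covers exactly one element. A join representation of $a\in L$ is a set of join-irreducible elements whose join is $a$. A set $A$ refines a set $B$ if every $x\in A$ satisfies $x\le y$ for some $y\in B$. The canonical join representation of $a$, if it exists, is the join representation of $a$ that is an antichain and refines every join representation of $a$. The faces of the canonical join complex of $L$ are the canonical join representations of the elements of $L$; they are closed under taking subsets. *Vertex decomposability.* A finite simplicial complex $\Delta$ (with $\emptyset$ as a face) is vertex decomposable if it is a simplex (the complex $\{\emptyset\}$ included), or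 if it has a vertex $v$ such that the link $\{G\in\Delta: v\notin G,\ G\cup\{v\}\in\Delta\}$ and the deletion $\{G\in\Delta: v\notin G\}$ are both vertex decomposable and no facet (inclusion-maximal face) of the link is a facet of the deletion. -/

import Mathlib

/-! ## Simplicial complexes and vertex decomposability

A simplicial complex is a family of finite sets closed under taking subsets, that is, a
`LowerSet (Finset α)`; the empty set counts as a face. -/

/-- A facet is a face that is maximal with respect to inclusion. -/
def IsFacet {α : Type*} (Δ : LowerSet (Finset α)) (F : Finset α) : Prop :=
  Maximal (fun G => G ∈ Δ) F

open scoped Classical in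
/-- The link `{G ∈ Δ : G ∩ F = ∅, G ∪ F ∈ Δ}` of `F`. -/
def complexLink {α : Type*} (Δ : LowerSet (Finset α)) (F : Finset α) : LowerSet (Finset α) where
  carrier := {G | G ∈ Δ ∧ Disjoint G F ∧ G ∪ F ∈ Δ}
  lower' := fun _ _ hle h =>
    ⟨Δ.lower hle h.1, Finset.disjoint_of_subset_left hle h.2.1,
      Δ.lower (Finset.union_subset_union_left hle) h.2.2⟩

/-- The deletion `{G ∈ Δ : F ⊄ G}` of `F`. -/
def complexDeletion {α : Type*} (Δ : LowerSet (Finset α)) (F : Finset α) :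
    LowerSet (Finset α) where
  carrier := {G | G ∈ Δ ∧ ¬ F ⊆ G}
  lower' := fun _ _ hle h => ⟨Δ.lower hle h.1, fun hF => h.2 (hF.trans hle)⟩

/-- (Non-pure) vertex decomposability: `Δ` is a simplex (the complex `{∅}` included), or it has a
vertex `v` such that the link and the deletion of `v` are vertex decomposable and no facet of the
link is a facet of the deletion. -/
inductive VertexDecomposable {α : Type*} : LowerSet (Finset α) → Prop
  | simplex (s : Finset α) : VertexDecomposable (LowerSet.Iic s)
  | decompose (Δ : LowerSet (Finset α)) (v : α) (hv : {v} ∈ Δ)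
      (hlink : VertexDecomposable (complexLink Δ {v}))
      (hdel : VertexDecomposable (complexDeletion Δ {v}))
      (hshed : ∀ F, IsFacet (complexLink Δ {v}) F → ¬ IsFacet (complexDeletion Δ {v}) F) :
      VertexDecomposable Δ

/-! ## Canonical join representations -/

/-- The partial order is a lattice: any two elements have a least upper bound and a greatest lower
bound. -/
def IsLatticeOrder (L : Type*) [PartialOrder L] : Prop :=
  ∀ a b : L, (∃ c, IsLUB {a, b} c) ∧ (∃ c, IsGLB {a, b} c)

/-- `j` is join-irreducible: it covers exactly one element. -/
def IsJoinIrreducible {L : Type*} [PartialOrder L] (j : L) : Prop :=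
  ∃! i, i ⋖ j

/-- `A` is a join representation of `a`: a set of join-irreducibles whose join is `a`. -/
def IsJoinRepresentation {L : Type*} [PartialOrder L] (A : Finset L) (a : L) : Prop :=
  (∀ j ∈ A, IsJoinIrreducible j) ∧ IsLUB (A : Set L) a

/-- `A` refines `B` if every element of `A` lies below some element of `B`. -/
def Refines {L : Type*} [PartialOrder L] (A B : Finset L) : Prop :=
  ∀ x ∈ A, ∃ y ∈ B, x ≤ y

/-- `A` is the canonical join representation of `a`: the smallest join representation of `a` under
refinement. Refinement is only a preorder on sets (adding to `A` an element below an element of `A`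
does not change the position of `A`); it is antisymmetric on antichains, and a canonical join
representation is an antichain. -/
def IsCanonicalJoinRepresentation {L : Type*} [PartialOrder L] (A : Finset L) (a : L) : Prop :=
  IsJoinRepresentation A a ∧ IsAntichain (· ≤ ·) (A : Set L) ∧
    ∀ B, IsJoinRepresentation B a → Refines A B

/-- Every finite subset (the empty one included) of a nonempty finite lattice has a join. -/
theorem IsLatticeOrder.exists_isLUB {L : Type*} [PartialOrder L] [Finite L]
    (hL : IsLatticeOrder L) (a₀ : L) (A : Finset L) : ∃ a, IsLUB (A : Set L) a := by
  classical
  induction A using Finset.induction_on with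
  | empty =>
    obtain ⟨m, hm⟩ := Set.Finite.exists_minimal (Set.toFinite (Set.univ : Set L)) ⟨a₀, trivial⟩
    refine ⟨m, by simp, fun b _ => ?_⟩
    obtain ⟨c, hc⟩ := (hL m b).2
    have h1 : c ≤ m := hc.1 (by simp)
    have h2 : c ≤ b := hc.1 (by simp)
    exact (hm.2 trivial h1).trans h2
  | insert x s _ ih =>
    obtain ⟨a, ha⟩ := ih
    obtain ⟨c, hc⟩ := (hL x a).1
    refine ⟨c, ?_, fun b hb => hc.2 ?_⟩
    · intro y hy
      rcases Finset.mem_insert.1 (Finset.mem_coe.1 hy) with rfl | hy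
      · exact hc.1 (by simp)
      · exact (ha.1 (Finset.mem_coe.2 hy)).trans (hc.1 (by simp))
    · intro y hy
      rcases hy with rfl | rfl
      · exact hb (by simp)
      · exact ha.2 fun z hz => hb (by simp [Finset.mem_coe.1 hz])

/-- The canonical join complex of a finite lattice: its faces are the canonical join
representations of the elements of the lattice. -/
def canonicalJoinComplex {L : Type*} [PartialOrder L] [Finite L] (hL : IsLatticeOrder L) :
    LowerSet (Finset L) where
  carrier := {A | ∃ a, IsCanonicalJoinRepresentation A a}
  lower' := by
    classical
    rintro A B hBA ⟨a, ⟨hirr, hlub⟩, hanti, hmin⟩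
    obtain ⟨b, hb⟩ := hL.exists_isLUB a B
    refine ⟨b, ⟨fun j hj => hirr j (hBA hj), hb⟩, hanti.subset (Finset.coe_subset.2 hBA), ?_⟩
    intro C hC x hx
    have hrep : IsJoinRepresentation (C ∪ (A \ B)) a := by
      refine ⟨fun j hj => ?_, ?_, ?_⟩
      · rcases Finset.mem_union.1 hj with h | h
        · exact hC.1 j h
        · exact hirr j (Finset.mem_sdiff.1 h).1
      · intro y hy
        rcases Finset.mem_union.1 (Finset.mem_coe.1 hy) with h | h
        · exact (hC.2.1 (Finset.mem_coe.2 h)).trans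
            (hb.2 fun z hz => hlub.1 (Finset.mem_coe.2 (hBA (Finset.mem_coe.1 hz))))
        · exact hlub.1 (Finset.mem_coe.2 (Finset.mem_sdiff.1 h).1)
      · intro u hu
        have hbu : b ≤ u := hC.2.2 fun z hz =>
          hu (Finset.mem_coe.2 (Finset.mem_union_left _ (Finset.mem_coe.1 hz)))
        refine hlub.2 fun z hz => ?_
        by_cases hzB : z ∈ B
        · exact (hb.1 (Finset.mem_coe.2 hzB)).trans hbu
        · exact hu (Finset.mem_coe.2 (Finset.mem_union_right _
            (Finset.mem_sdiff.2 ⟨Finset.mem_coe.1 hz, hzB⟩)))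
    obtain ⟨y, hy, hxy⟩ := hmin _ hrep x (hBA hx)
    rcases Finset.mem_union.1 hy with h | h
    · exact ⟨y, h, hxy⟩
    · obtain ⟨hyA, hyB⟩ := Finset.mem_sdiff.1 h
      have : x = y := hanti.eq (Finset.mem_coe.2 (hBA hx)) (Finset.mem_coe.2 hyA) hxy
      exact absurd (this ▸ hx) hyB

/-! ## The alt ν-Tamari lattice

`ν = (ν₀, …, νₙ)` is the north-east path `E^{ν₀} N E^{ν₁} … N E^{νₙ}` and `δ = (δ₁, …, δₙ)` is an
increment vector; the entry `δᵢ` is `δ (i - 1)` for `δ : Fin n → ℕ`. Lattice points are pairs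
`(x, y)` with `x : ℤ` and `y : ℕ`. -/

/-- The number `ν₀ + ⋯ + νₙ - (δ₁ + ⋯ + δₙ)` of initial east steps of the path
`ν̌ = E^{ν̌₀} N E^{δ₁} … N E^{δₙ}`, which starts at the origin. -/
def checkZero {n : ℕ} (ν : Fin (n + 1) → ℕ) (δ : Fin n → ℕ) : ℤ :=
  ∑ i, (ν i : ℤ) - ∑ i, (δ i : ℤ)

/-- The largest abscissa `ν̌₀ + δ₁ + ⋯ + δ_y` on the path `ν̌` at height `y`. -/
def checkEnd {n : ℕ} (ν : Fin (n + 1) → ℕ) (δ : Fin n → ℕ) (y : ℕ) : ℤ :=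
  checkZero ν δ + ∑ i ∈ Finset.univ.filter (fun i : Fin n => i.val < y), (δ i : ℤ)

/-- The smallest abscissa `ν̌₀ - ν₀ - (ν₁ - δ₁) - ⋯ - (ν_y - δ_y)` at height `y` on the north-west
path `ν̂ = W^{ν₀} N W^{ν₁ - δ₁} … N W^{νₙ - δₙ}`, which starts at `(ν̌₀, 0)`. -/
def hatEnd {n : ℕ} (ν : Fin (n + 1) → ℕ) (δ : Fin n → ℕ) (y : ℕ) : ℤ :=
  checkZero ν δ - ν 0 -
    ∑ i ∈ Finset.univ.filter (fun i : Fin n => i.val < y), ((ν i.succ : ℤ) - δ i)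

/-- The lattice points of the Ferrers diagram of `ν̌`: those of the bounding rectangle of `ν̌` that
lie weakly above `ν̌`. -/
def checkRegion {n : ℕ} (ν : Fin (n + 1) → ℕ) (δ : Fin n → ℕ) : Set (ℤ × ℕ) :=
  {p | p.2 ≤ n ∧ 0 ≤ p.1 ∧ p.1 ≤ checkEnd ν δ p.2}

/-- The lattice points of the diagram of `ν̌` that lie weakly above `ν̂`. -/
def shapePoints {n : ℕ} (ν : Fin (n + 1) → ℕ) (δ : Fin n → ℕ) : Set (ℤ × ℕ) :=
  {p | p ∈ checkRegion ν δ ∧ hatEnd ν δ p.2 ≤ p.1}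

/-- One point is strictly southwest of the other, and the smallest rectangle `Set.uIcc p q`
containing both lies inside the diagram of `ν̌`. Since the diagram is a union of unit boxes bounded
by a staircase, it is enough to look at the lattice points of the rectangle. -/
def Incompatible {n : ℕ} (ν : Fin (n + 1) → ℕ) (δ : Fin n → ℕ) (p q : ℤ × ℕ) : Prop :=
  ((p.1 < q.1 ∧ p.2 < q.2) ∨ (q.1 < p.1 ∧ q.2 < p.2)) ∧ Set.uIcc p q ⊆ checkRegion ν δ

/-- A `(δ, ν)`-tree: a maximal collection of pairwise compatible points of the shape. -/
def IsTree {n : ℕ} (ν : Fin (n + 1) → ℕ) (δ : Fin n → ℕ) (T : Finset (ℤ × ℕ)) : Prop :=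
  Maximal (fun S : Finset (ℤ × ℕ) => (S : Set (ℤ × ℕ)) ⊆ shapePoints ν δ ∧
    ∀ p ∈ S, ∀ q ∈ S, ¬ Incompatible ν δ p q) T

/-- The underlying set of the alt `ν`-Tamari lattice: the `(δ, ν)`-trees. -/
def AltTamari {n : ℕ} (ν : Fin (n + 1) → ℕ) (δ : Fin n → ℕ) : Type :=
  {T : Finset (ℤ × ℕ) // IsTree ν δ T}

/-- `T'` is obtained from `T` by a right rotation: the node `q = (x, y)` of `T`, which has the node
`p = (x, y')` above it and the node `r = (x', y)` to its right, is exchanged with `q' = (x', y')`,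
and the rectangle spanned by `p` and `r` contains no nodes of `T` besides `p`, `q`, `r`. -/
def IsRightRotation {n : ℕ} {ν : Fin (n + 1) → ℕ} {δ : Fin n → ℕ} (T T' : AltTamari ν δ) : Prop :=
  ∃ (x x' : ℤ) (y y' : ℕ), x < x' ∧ y < y' ∧
    (x, y') ∈ T.1 ∧ (x, y) ∈ T.1 ∧ (x', y) ∈ T.1 ∧
    (∀ s ∈ T.1, s ∈ Set.Icc (x, y) (x', y') → s = (x, y') ∨ s = (x, y) ∨ s = (x', y)) ∧
    T'.1 = insert (x', y') (T.1.erase (x, y))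

/-- A right rotation increases the sum of the heights of the nodes. -/
theorem IsRightRotation.sum_lt {n : ℕ} {ν : Fin (n + 1) → ℕ} {δ : Fin n → ℕ}
    {T T' : AltTamari ν δ} (h : IsRightRotation T T') :
    ∑ p ∈ T.1, p.2 < ∑ p ∈ T'.1, p.2 := by
  obtain ⟨x, x', y, y', hx, hy, _, hq, _, hempty, hT'⟩ := h
  have hq' : (x', y') ∉ T.1.erase (x, y) := by
    intro hmem
    rcases hempty _ (Finset.mem_of_mem_erase hmem)
      ⟨Prod.mk_le_mk.2 ⟨hx.le, hy.le⟩, le_rfl⟩ with h | h | h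
    · exact hx.ne' (Prod.mk.inj h).1
    · exact hx.ne' (Prod.mk.inj h).1
    · exact hy.ne' (Prod.mk.inj h).2
  rw [hT', Finset.sum_insert hq', ← Finset.add_sum_erase _ _ hq]
  exact Nat.add_lt_add_right hy _

/-- The rotation order: the reflexive and transitive closure of right rotations. -/
instance AltTamari.instPartialOrder {n : ℕ} (ν : Fin (n + 1) → ℕ) (δ : Fin n → ℕ) :
    PartialOrder (AltTamari ν δ) where
  le T T' := Relation.ReflTransGen IsRightRotation T T'
  le_refl _ := Relation.ReflTransGen.refl
  le_trans _ _ _ := Relation.ReflTransGen.trans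
  le_antisymm T T' h h' := by
    have key : ∀ {S S' : AltTamari ν δ}, Relation.ReflTransGen IsRightRotation S S' →
        S = S' ∨ ∑ p ∈ S.1, p.2 < ∑ p ∈ S'.1, p.2 := by
      intro S S' hS
      induction hS with
      | refl => exact Or.inl rfl
      | tail _ hr ih =>
        rcases ih with rfl | ih
        · exact Or.inr hr.sum_lt
        · exact Or.inr (ih.trans hr.sum_lt)
    rcases key h with h | h
    · exact h
    · rcases key h' with h' | h'
      · exact h'.symm
      · exact absurd (h.trans h') (lt_irrefl _)

instance AltTamari.instFinite {n : ℕ} (ν : Fin (n + 1) → ℕ) (δ : Fin n → ℕ) :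
    Finite (AltTamari ν δ) := by
  have hfin : (shapePoints ν δ).Finite := by
    refine Set.Finite.subset
      (Set.finite_Icc ((0 : ℤ), (0 : ℕ)) (checkZero ν δ + ∑ i, (δ i : ℤ), n)) ?_
    rintro ⟨x, y⟩ ⟨⟨hy, hx0, hx⟩, _⟩
    refine ⟨Prod.mk_le_mk.2 ⟨hx0, Nat.zero_le _⟩, Prod.mk_le_mk.2 ⟨hx.trans ?_, hy⟩⟩
    exact add_le_add le_rfl (Finset.sum_le_sum_of_subset_of_nonneg (Finset.filter_subset _ _)
      fun i _ _ => Int.natCast_nonneg _)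
  have hpow : {S : Finset (ℤ × ℕ) | (S : Set (ℤ × ℕ)) ⊆ shapePoints ν δ}.Finite :=
    Set.Finite.preimage Finset.coe_injective.injOn hfin.finite_subsets
  exact (hpow.subset (fun T (hT : IsTree ν δ T) => Maximal.prop hT |>.1)).to_subtype

/-!
Write `h = hatEnd ν δ` (decreasing) and `c = checkEnd ν δ` (increasing), so that row `y` of the
shape is `[h y, c y]`, and `(x, y)`, `(x', y')` with `y < y'` are incompatible iff `x < x' ≤ c y`.

*The lattice.* A tree `T` is determined by the leftmost abscissa `A y = rowMin T y` of each row.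
The functions that occur are those with `h ≤ A ≤ c`, `A n = h n` and, for `y < y'`, either
`A y' ≤ A y` or `c y < A y'` (`IsRowVector`, `mem_tree_iff`, `treeOf`). A right rotation raises one value
of `A`, and conversely the rotation order is the componentwise order of these functions
(`altTamari_le_iff`). They are closed under componentwise maximum and have the minimum `h`; hence
the order is a lattice in which joins are componentwise maxima.

*Canonical join representations.* Among the functions `A` with a given value `A y = x > h y` there
is a smallest one, `irrVector ν δ x y`, and it is join-irreducible. Since each value above `h` of
a join is attained by a joinand, every join representation of `A` has a member with value `A y` in
row `y` whenever `A y > h y`, and this member lies above `irrVector ν δ (A y) y`. So the maximal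
ones among these `irrVector ν δ (A y) y` form the canonical join representation. The canonical
join complex is then the independence complex of a graph on the labels `(x, y)` with
`h y < x ≤ c y`: two labels are adjacent if one is weakly southwest of the other and the southeast corner of
their rectangle is not beyond `c` (`canonicalJoinComplex_eq`).

*Vertex decomposability.* If the closed neighborhood of `w` is contained in that of a neighbor
`v`, then `v` is a shedding vertex of the independence complex. For the labels in any set of
columns and any set of rows, let `w` be the rightmost label of the lowest row. Its neighbors are
the other labels of its row and its column, and they form a clique, so that all of them can be
shed. Each link that arises is again given by a set of columns and a set of rows, or is the join
of two such complexes, and induction on the set of rows applies (`dismantlable_diagram`).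
-/

/-! ### The two boundary paths -/

section Boundary

variable {n : ℕ} {ν : Fin (n + 1) → ℕ} {δ : Fin n → ℕ}

theorem checkEnd_mono (ν : Fin (n + 1) → ℕ) (δ : Fin n → ℕ) : Monotone (checkEnd ν δ) := by
  intro a b hab
  refine add_le_add le_rfl (Finset.sum_le_sum_of_subset_of_nonneg ?_ fun i _ _ => by positivity)
  intro i hi
  simp only [Finset.mem_filter, Finset.mem_univ, true_and] at hi ⊢
  omega

theorem hatEnd_anti (hδ : ∀ i : Fin n, δ i ≤ ν i.succ) : Antitone (hatEnd ν δ) := by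
  intro a b hab
  refine sub_le_sub le_rfl (Finset.sum_le_sum_of_subset_of_nonneg ?_ fun i _ _ => ?_)
  · intro i hi
    simp only [Finset.mem_filter, Finset.mem_univ, true_and] at hi ⊢
    omega
  · have := hδ i
    omega

theorem hatEnd_le_checkEnd (hδ : ∀ i : Fin n, δ i ≤ ν i.succ) (y : ℕ) :
    hatEnd ν δ y ≤ checkEnd ν δ y := by
  have h1 := hatEnd_anti hδ (Nat.zero_le y)
  have h2 := checkEnd_mono ν δ (Nat.zero_le y)
  have h3 : hatEnd ν δ 0 = checkZero ν δ - ν 0 := by simp [hatEnd]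
  have h4 : checkEnd ν δ 0 = checkZero ν δ := by simp [checkEnd]
  omega

theorem hatEnd_top (ν : Fin (n + 1) → ℕ) (δ : Fin n → ℕ) : hatEnd ν δ n = 0 := by
  simp only [hatEnd, checkZero, Fin.sum_univ_succ, Fin.is_lt, Finset.filter_true,
    Finset.sum_sub_distrib]
  ring

theorem mem_shapePoints (hδ : ∀ i : Fin n, δ i ≤ ν i.succ) {x : ℤ} {y : ℕ} :
    (x, y) ∈ shapePoints ν δ ↔ y ≤ n ∧ hatEnd ν δ y ≤ x ∧ x ≤ checkEnd ν δ y := by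
  constructor
  · rintro ⟨⟨h1, _, h3⟩, h4⟩
    exact ⟨h1, h4, h3⟩
  · rintro ⟨h1, h2, h3⟩
    have := hatEnd_anti hδ h1
    rw [hatEnd_top] at this
    exact ⟨⟨h1, this.trans h2, h3⟩, h2⟩

theorem incompatible_comm {p q : ℤ × ℕ} : Incompatible ν δ p q ↔ Incompatible ν δ q p := by
  unfold Incompatible
  rw [Set.uIcc_comm, or_comm]

/-- The smallest rectangle containing two points in southwest-northeast position lies in the
diagram of `ν̌` as soon as its southeast corner does. -/
theorem incompatible_of_lt {x x' : ℤ} {y y' : ℕ} (hp : (x, y) ∈ shapePoints ν δ)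
    (hq : (x', y') ∈ shapePoints ν δ) (hy : y < y') :
    Incompatible ν δ (x, y) (x', y') ↔ x < x' ∧ x' ≤ checkEnd ν δ y := by
  constructor
  · rintro ⟨h | h, hsub⟩
    · refine ⟨h.1, (hsub (a := (x', y)) ?_).2.2⟩
      rw [Set.uIcc_of_le (Prod.mk_le_mk.2 ⟨h.1.le, hy.le⟩)]
      exact ⟨Prod.mk_le_mk.2 ⟨h.1.le, le_rfl⟩, Prod.mk_le_mk.2 ⟨le_rfl, hy.le⟩⟩
    · exact absurd h.2 (by simpa using hy.le)
  · rintro ⟨hx, hc⟩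
    refine ⟨Or.inl ⟨hx, hy⟩, ?_⟩
    rw [Set.uIcc_of_le (Prod.mk_le_mk.2 ⟨hx.le, hy.le⟩)]
    rintro ⟨a, b⟩ ⟨h1, h2⟩
    obtain ⟨h1, h3⟩ := Prod.mk_le_mk.1 h1
    obtain ⟨h2, h4⟩ := Prod.mk_le_mk.1 h2
    exact ⟨h4.trans hq.1.1, hp.1.2.1.trans h1, (h2.trans hc).trans (checkEnd_mono ν δ h3)⟩

end Boundary

/-! ### Trees and their row minima -/

/-- The abscissa of the leftmost node of `T` at height `y`; junk value `0` for `y > n`, where `T`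
has no nodes. -/
noncomputable def rowMin {n : ℕ} {ν : Fin (n + 1) → ℕ} {δ : Fin n → ℕ} (T : AltTamari ν δ)
    (y : ℕ) : ℤ :=
  sInf {x | (x, y) ∈ T.1}

/-- The functions `A` that arise as row minima of trees: the points `(A y, y)` with `y ≤ n` lie in
the shape and are pairwise compatible, and `A n` is the corner of the shape. Only the values `A y`
with `y ≤ n` matter. -/
structure IsRowVector {n : ℕ} (ν : Fin (n + 1) → ℕ) (δ : Fin n → ℕ) (A : ℕ → ℤ) : Prop where
  hat_le : ∀ y ≤ n, hatEnd ν δ y ≤ A y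
  le_check : ∀ y ≤ n, A y ≤ checkEnd ν δ y
  top : A n = hatEnd ν δ n
  compat : ∀ y y', y < y' → y' ≤ n → A y' ≤ A y ∨ checkEnd ν δ y < A y'

/-- The point `(x, y)` of the shape is not to the left of `(A y, y)` and is compatible with all
points `(A u, u)`. -/
structure IsNode {n : ℕ} (ν : Fin (n + 1) → ℕ) (δ : Fin n → ℕ) (A : ℕ → ℤ) (x : ℤ) (y : ℕ) :
    Prop where
  le_top : y ≤ n
  min_le : A y ≤ x
  le_check : x ≤ checkEnd ν δ y
  compat_below : ∀ u < y, A u < x → checkEnd ν δ u < x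
  compat_above : ∀ u, y < u → u ≤ n → x < A u → checkEnd ν δ y < A u

section Trees

variable {n : ℕ} {ν : Fin (n + 1) → ℕ} {δ : Fin n → ℕ}

theorem AltTamari.mem_shape (T : AltTamari ν δ) {p : ℤ × ℕ} (hp : p ∈ T.1) :
    p ∈ shapePoints ν δ :=
  T.2.prop.1 hp

theorem AltTamari.compat (T : AltTamari ν δ) {x x' : ℤ} {y y' : ℕ} (hp : (x, y) ∈ T.1)
    (hq : (x', y') ∈ T.1) (hy : y < y') (hx : x < x') : checkEnd ν δ y < x' := by
  by_contra! h
  exact T.2.prop.2 _ hp _ hq ((incompatible_of_lt (T.mem_shape hp) (T.mem_shape hq) hy).2 ⟨hx, h⟩)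

theorem AltTamari.mem_of_compat (hδ : ∀ i : Fin n, δ i ≤ ν i.succ) (T : AltTamari ν δ) {x : ℤ}
    {y : ℕ} (hy : y ≤ n) (h1 : hatEnd ν δ y ≤ x) (h2 : x ≤ checkEnd ν δ y)
    (hsw : ∀ a b, (a, b) ∈ T.1 → b < y → a < x → checkEnd ν δ b < x)
    (hne : ∀ a b, (a, b) ∈ T.1 → y < b → x < a → checkEnd ν δ y < a) : (x, y) ∈ T.1 := by
  classical
  have hp : (x, y) ∈ shapePoints ν δ := (mem_shapePoints hδ).2 ⟨hy, h1, h2⟩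
  have key : ∀ q ∈ T.1, ¬ Incompatible ν δ (x, y) q := by
    rintro ⟨a, b⟩ hq hinc
    rcases lt_trichotomy y b with hb | rfl | hb
    · obtain ⟨h3, h4⟩ := (incompatible_of_lt hp (T.mem_shape hq) hb).1 hinc
      exact (hne a b hq hb h3).not_ge h4
    · rcases hinc.1 with h | h <;> exact lt_irrefl _ h.2
    · obtain ⟨h3, h4⟩ :=
        (incompatible_of_lt (T.mem_shape hq) hp hb).1 (incompatible_comm.1 hinc)
      exact (hsw a b hq hb h3).not_ge h4
  have hins := T.2.le_of_ge (y := insert (x, y) T.1) ⟨?_, ?_⟩ (Finset.subset_insert _ _)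
  · exact hins (Finset.mem_insert_self _ _)
  · rw [Finset.coe_insert]
    exact Set.insert_subset hp T.2.prop.1
  · intro p hp' q hq
    rcases Finset.mem_insert.1 hp' with rfl | hp' <;> rcases Finset.mem_insert.1 hq with rfl | hq
    · rintro ⟨h | h, _⟩ <;> exact lt_irrefl _ h.1
    · exact key q hq
    · exact fun h => key p hp' (incompatible_comm.1 h)
    · exact T.2.prop.2 p hp' q hq

/-- Every row contains a node: no two nodes obstruct the leftmost point of the row that is
compatible with all nodes above the row. -/
theorem AltTamari.exists_mem_row (hδ : ∀ i : Fin n, δ i ≤ ν i.succ) (T : AltTamari ν δ) {y : ℕ}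
    (hy : y ≤ n) : ∃ x, (x, y) ∈ T.1 := by
  classical
  set S : Finset ℤ := insert (hatEnd ν δ y)
    ((T.1.filter fun p => y < p.2 ∧ p.1 ≤ checkEnd ν δ y).image Prod.fst) with hS
  have hne : S.Nonempty := ⟨_, Finset.mem_insert_self _ _⟩
  have hmax := S.max'_mem hne
  set x := S.max' hne with hx
  have hle : ∀ a ∈ S, a ≤ x := fun a ha => S.le_max' a ha
  have h1 : hatEnd ν δ y ≤ x := hle _ (Finset.mem_insert_self _ _)
  have hcases : x = hatEnd ν δ y ∨ ∃ b, (x, b) ∈ T.1 ∧ y < b ∧ x ≤ checkEnd ν δ y := by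
    rcases Finset.mem_insert.1 hmax with h | h
    · exact Or.inl h
    · obtain ⟨⟨a, b⟩, hp, rfl⟩ := Finset.mem_image.1 h
      obtain ⟨hp, h2, h3⟩ := Finset.mem_filter.1 hp
      exact Or.inr ⟨b, hp, h2, h3⟩
  refine ⟨x, T.mem_of_compat hδ hy h1 ?_ ?_ ?_⟩
  · rcases hcases with h | ⟨b, _, _, h⟩
    · exact h ▸ hatEnd_le_checkEnd hδ y
    · exact h
  · intro a b hab hb ha
    rcases hcases with h | ⟨b', hb', h2, _⟩
    · have := hatEnd_anti hδ hb.le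
      have := (T.mem_shape hab).2
      simp only at this
      omega
    · exact T.compat hab hb' (hb.trans h2) ha
  · intro a b hab hb ha
    by_contra! hc
    refine ha.not_ge (hle a (Finset.mem_insert_of_mem (Finset.mem_image.2 ⟨(a, b), ?_, rfl⟩)))
    exact Finset.mem_filter.2 ⟨hab, hb, hc⟩

theorem bddBelow_row (T : AltTamari ν δ) (y : ℕ) : BddBelow {x | (x, y) ∈ T.1} :=
  ⟨0, fun _ hx => (T.mem_shape hx).1.2.1⟩

theorem rowMin_mem (hδ : ∀ i : Fin n, δ i ≤ ν i.succ) (T : AltTamari ν δ) {y : ℕ} (hy : y ≤ n) :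
    (rowMin T y, y) ∈ T.1 :=
  Int.csInf_mem (T.exists_mem_row hδ hy) (bddBelow_row T y)

theorem rowMin_le (T : AltTamari ν δ) {x : ℤ} {y : ℕ} (h : (x, y) ∈ T.1) : rowMin T y ≤ x :=
  csInf_le (bddBelow_row T y) h

theorem isRowVector_rowMin (hδ : ∀ i : Fin n, δ i ≤ ν i.succ) (T : AltTamari ν δ) :
    IsRowVector ν δ (rowMin T) where
  hat_le y hy := (T.mem_shape (rowMin_mem hδ T hy)).2
  le_check y hy := (T.mem_shape (rowMin_mem hδ T hy)).1.2.2
  top := by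
    refine le_antisymm (rowMin_le T (T.mem_of_compat hδ le_rfl le_rfl (hatEnd_le_checkEnd hδ n)
      ?_ ?_)) (T.mem_shape (rowMin_mem hδ T le_rfl)).2
    · intro a b hab hb ha
      have h1 := hatEnd_anti hδ hb.le
      have h2 := (T.mem_shape hab).2
      simp only at h2
      omega
    · intro a b hab hb _
      exact absurd (T.mem_shape hab).1.1 hb.not_ge
  compat y y' hy hy' := by
    rw [or_iff_not_imp_left, not_le]
    exact T.compat (rowMin_mem hδ T (hy.le.trans hy')) (rowMin_mem hδ T hy') hy

/-- A tree is determined by its row minima. -/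
theorem mem_tree_iff (hδ : ∀ i : Fin n, δ i ≤ ν i.succ) (T : AltTamari ν δ) {x : ℤ} {y : ℕ} :
    (x, y) ∈ T.1 ↔ IsNode ν δ (rowMin T) x y := by
  constructor
  · intro h
    have hy : y ≤ n := (T.mem_shape h).1.1
    exact ⟨hy, rowMin_le T h, (T.mem_shape h).1.2.2,
      fun u hu => T.compat (rowMin_mem hδ T (hu.le.trans hy)) h hu,
      fun u hu hu' => T.compat h (rowMin_mem hδ T hu') hu⟩
  · rintro ⟨hy, h1, h2, h3, h4⟩
    refine T.mem_of_compat hδ hy (((isRowVector_rowMin hδ T).hat_le y hy).trans h1) h2 ?_ ?_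
    · exact fun a b hab hb ha => h3 b hb ((rowMin_le T hab).trans_lt ha)
    · exact fun a b hab hb ha => T.compat (rowMin_mem hδ T hy) hab hb (h1.trans_lt ha)

open scoped Classical in
/-- The points that satisfy `IsNode` for `A`. -/
noncomputable def nodeSet (ν : Fin (n + 1) → ℕ) (δ : Fin n → ℕ) (A : ℕ → ℤ) : Finset (ℤ × ℕ) :=
  (Finset.Icc ((0 : ℤ), 0) (checkEnd ν δ n, n)).filter fun p => IsNode ν δ A p.1 p.2

theorem mem_nodeSet (hδ : ∀ i : Fin n, δ i ≤ ν i.succ) {A : ℕ → ℤ} (hA : IsRowVector ν δ A)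
    {x : ℤ} {y : ℕ} : (x, y) ∈ nodeSet ν δ A ↔ IsNode ν δ A x y := by
  classical
  rw [nodeSet, Finset.mem_filter]
  refine ⟨fun h => h.2, fun h => ⟨?_, h⟩⟩
  have h1 := hA.hat_le y h.le_top
  have h2 := hatEnd_anti hδ h.le_top
  rw [hatEnd_top] at h2
  have h3 := checkEnd_mono ν δ h.le_top
  exact Finset.mem_Icc.2 ⟨Prod.mk_le_mk.2 ⟨(h2.trans h1).trans h.min_le, Nat.zero_le _⟩,
    Prod.mk_le_mk.2 ⟨h.le_check.trans h3, h.le_top⟩⟩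

theorem IsRowVector.isNode {A : ℕ → ℤ} (hA : IsRowVector ν δ A) {y : ℕ} (hy : y ≤ n) :
    IsNode ν δ A (A y) y :=
  ⟨hy, le_rfl, hA.le_check y hy, fun u hu h => (hA.compat u y hu hy).resolve_left h.not_ge,
    fun u hu hu' h => (hA.compat y u hu hu').resolve_left h.not_ge⟩

/-- Directly above the leftmost node `(A y, y)` of its row, in the same column, comes the node in
the first higher row whose minimum is at most `A y`. -/
theorem IsRowVector.isNode_above {A : ℕ → ℤ} (hA : IsRowVector ν δ A) {y z : ℕ} (hyz : y < z)
    (hz : z ≤ n) (hAz : A z ≤ A y) (hmin : ∀ u, y < u → u < z → A y < A u) :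
    IsNode ν δ A (A y) z := by
  have hy := hA.isNode (hyz.le.trans hz)
  refine ⟨hz, hAz, hy.le_check.trans (checkEnd_mono ν δ hyz.le), fun u hu hux => ?_,
    fun u hu hu' hux => (hA.compat z u hu hu').resolve_left (hAz.trans_lt hux).not_ge⟩
  rcases lt_trichotomy u y with h1 | rfl | h1
  · exact hy.compat_below u h1 hux
  · exact absurd hux (lt_irrefl _)
  · exact absurd (hmin u h1 hu) hux.not_gt

/-- In a column that meets row `y` in its leftmost node, there is a first higher node. -/
theorem IsRowVector.exists_above (hδ : ∀ i : Fin n, δ i ≤ ν i.succ) {A : ℕ → ℤ}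
    (hA : IsRowVector ν δ A) {y : ℕ} (hy : y < n) :
    ∃ z, y < z ∧ z ≤ n ∧ A z ≤ A y ∧ ∀ u, y < u → u < z → A y < A u := by
  classical
  have hex : ∃ z, y < z ∧ z ≤ n ∧ A z ≤ A y :=
    ⟨n, hy, le_rfl, hA.top.trans_le ((hatEnd_anti hδ hy.le).trans (hA.hat_le y hy.le))⟩
  obtain ⟨h1, h2, h3⟩ := Nat.find_spec hex
  refine ⟨Nat.find hex, h1, h2, h3, fun u hu hu' => ?_⟩
  by_contra! h
  exact Nat.find_min hex hu' ⟨hu, hu'.le.trans h2, h⟩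

/-- The points `IsNode` for `A` form a tree. For maximality, suppose that a point to the left of
`(A y, y)` could be added; it would be incompatible with the node directly above `(A y, y)`. -/
theorem IsRowVector.isTree (hδ : ∀ i : Fin n, δ i ≤ ν i.succ) {A : ℕ → ℤ}
    (hA : IsRowVector ν δ A) : IsTree ν δ (nodeSet ν δ A) := by
  have hshape : ∀ {x y}, IsNode ν δ A x y → (x, y) ∈ shapePoints ν δ := fun h =>
    (mem_shapePoints hδ).2 ⟨h.le_top, (hA.hat_le _ h.le_top).trans h.min_le, h.le_check⟩
  have hlt : ∀ {x y a b}, IsNode ν δ A x y → IsNode ν δ A a b → y < b →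
      ¬ Incompatible ν δ (x, y) (a, b) := by
    intro x y a b h h' hyb hinc
    obtain ⟨h1, h2⟩ := (incompatible_of_lt (hshape h) (hshape h') hyb).1 hinc
    exact (h'.compat_below y hyb (h.min_le.trans_lt h1)).not_ge h2
  refine ⟨⟨?_, ?_⟩, ?_⟩
  · rintro ⟨x, y⟩ h
    exact hshape ((mem_nodeSet hδ hA).1 h)
  · rintro ⟨x, y⟩ hp ⟨a, b⟩ hq hinc
    rw [mem_nodeSet hδ hA] at hp hq
    rcases lt_trichotomy y b with h | rfl | h
    · exact hlt hp hq h hinc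
    · rcases hinc.1 with h | h <;> exact lt_irrefl _ h.2
    · exact hlt hq hp h (incompatible_comm.1 hinc)
  · rintro S ⟨hS, hS'⟩ hle ⟨x, y⟩ hp
    have hps := hS hp
    obtain ⟨hy, h1, h2⟩ := (mem_shapePoints hδ).1 hps
    have hcompat : ∀ {a b}, IsNode ν δ A a b → ¬ Incompatible ν δ (x, y) (a, b) :=
      fun h => hS' _ hp _ (hle ((mem_nodeSet hδ hA).2 h))
    refine (mem_nodeSet hδ hA).2 ⟨hy, ?_, h2, fun u hu hux => ?_, fun u hu hu' hux => ?_⟩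
    · by_contra! hxA
      have hyn : y < n := by
        refine lt_of_le_of_ne hy ?_
        rintro rfl
        rw [hA.top] at hxA
        exact hxA.not_ge h1
      obtain ⟨z, hz1, hz2, hz3, hz4⟩ := hA.exists_above hδ hyn
      have hnode := hA.isNode_above hz1 hz2 hz3 hz4
      exact hcompat hnode ((incompatible_of_lt hps (hshape hnode) hz1).2
        ⟨hxA, hA.le_check y hy⟩)
    · have hnode := hA.isNode (hu.le.trans hy)
      by_contra! h
      exact hcompat hnode (incompatible_comm.1
        ((incompatible_of_lt (hshape hnode) hps hu).2 ⟨hux, h⟩))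
    · have hnode := hA.isNode hu'
      by_contra! h
      exact hcompat hnode ((incompatible_of_lt hps (hshape hnode) hu).2 ⟨hux, h⟩)

/-- The tree with row minima `A`. -/
noncomputable def treeOf (hδ : ∀ i : Fin n, δ i ≤ ν i.succ) {A : ℕ → ℤ}
    (hA : IsRowVector ν δ A) : AltTamari ν δ :=
  ⟨nodeSet ν δ A, hA.isTree hδ⟩

theorem mem_treeOf (hδ : ∀ i : Fin n, δ i ≤ ν i.succ) {A : ℕ → ℤ} (hA : IsRowVector ν δ A) {x : ℤ}
    {y : ℕ} : (x, y) ∈ (treeOf hδ hA).1 ↔ IsNode ν δ A x y :=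
  mem_nodeSet hδ hA

theorem rowMin_treeOf (hδ : ∀ i : Fin n, δ i ≤ ν i.succ) {A : ℕ → ℤ} (hA : IsRowVector ν δ A)
    {y : ℕ} (hy : y ≤ n) : rowMin (treeOf hδ hA) y = A y :=
  le_antisymm (rowMin_le _ ((mem_treeOf hδ hA).2 (hA.isNode hy)))
    ((mem_treeOf hδ hA).1 (rowMin_mem hδ _ hy)).min_le

theorem eq_of_rowMin_eq (hδ : ∀ i : Fin n, δ i ≤ ν i.succ) {T T' : AltTamari ν δ}
    (h : ∀ y ≤ n, rowMin T y = rowMin T' y) : T = T' := by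
  refine Subtype.ext (Finset.ext ?_)
  have key : ∀ {S S' : AltTamari ν δ}, (∀ y ≤ n, rowMin S y = rowMin S' y) → ∀ {x y},
      (x, y) ∈ S.1 → (x, y) ∈ S'.1 := by
    intro S S' h x y hp
    rw [mem_tree_iff hδ] at hp ⊢
    exact ⟨hp.le_top, h y hp.le_top ▸ hp.min_le, hp.le_check,
      fun u hu => h u (hu.le.trans hp.le_top) ▸ hp.compat_below u hu,
      fun u hu hu' => h u hu' ▸ hp.compat_above u hu hu'⟩
  exact fun ⟨x, y⟩ => ⟨key h, key fun y hy => (h y hy).symm⟩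

end Trees

/-! ### The rotation order is the componentwise order of row minima -/

section Order

variable {n : ℕ} {ν : Fin (n + 1) → ℕ} {δ : Fin n → ℕ}

theorem IsRightRotation.rowMin_le (hδ : ∀ i : Fin n, δ i ≤ ν i.succ) {T T' : AltTamari ν δ}
    (h : IsRightRotation T T') {y : ℕ} (hy : y ≤ n) : rowMin T y ≤ rowMin T' y := by
  obtain ⟨a, a', b, b', ha, _, hp, _, _, _, hT'⟩ := h
  have hmem := rowMin_mem hδ T' hy
  rw [hT', Finset.mem_insert] at hmem
  rcases hmem with h | h
  · obtain ⟨h1, rfl⟩ := Prod.mk.inj h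
    rw [h1]
    exact (_root_.rowMin_le T hp).trans ha.le
  · exact _root_.rowMin_le T (Finset.mem_of_mem_erase h)

/-- If `(x', y)` is the second node from the left in a row `y < n`, then `T` admits the rotation
that removes the leftmost node of that row. -/
theorem exists_rotation (hδ : ∀ i : Fin n, δ i ≤ ν i.succ) (T : AltTamari ν δ) {y : ℕ} (hy : y < n)
    {x' : ℤ} (hx : rowMin T y < x') (hmem : (x', y) ∈ T.1)
    (hnext : ∀ a, (a, y) ∈ T.1 → rowMin T y < a → x' ≤ a) :
    ∃ T', IsRightRotation T T' ∧ rowMin T' y = x' ∧ ∀ u ≤ n, u ≠ y → rowMin T' u = rowMin T u := by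
  set A := rowMin T with hAdef
  have hA : IsRowVector ν δ A := isRowVector_rowMin hδ T
  have hnode : ∀ {a b}, (a, b) ∈ T.1 ↔ IsNode ν δ A a b := mem_tree_iff hδ T
  have hx' : IsNode ν δ A x' y := hnode.1 hmem
  have hself : Function.update A y x' y = x' := Function.update_self ..
  have hother : ∀ {u}, u ≠ y → Function.update A y x' u = A u := fun h =>
    Function.update_of_ne h ..
  have hB : IsRowVector ν δ (Function.update A y x') := by
    refine ⟨fun u hu => ?_, fun u hu => ?_, ?_, fun u u' hu hu' => ?_⟩
    · rcases eq_or_ne u y with rfl | h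
      · rw [hself]
        exact (hA.hat_le u hu).trans hx.le
      · rw [hother h]
        exact hA.hat_le u hu
    · rcases eq_or_ne u y with rfl | h
      · rw [hself]
        exact hx'.le_check
      · rw [hother h]
        exact hA.le_check u hu
    · rw [hother hy.ne']
      exact hA.top
    · rcases eq_or_ne u y with rfl | h
      · rw [hself, hother hu.ne', or_iff_not_imp_left, not_le]
        exact hx'.compat_above u' hu hu'
      · rcases eq_or_ne u' y with rfl | h'
        · rw [hself, hother h, or_iff_not_imp_left, not_le]
          exact hx'.compat_below u hu
        · rw [hother h, hother h']
          exact hA.compat u u' hu hu'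
  obtain ⟨y', hyy', hy', hAy', hmin⟩ := hA.exists_above hδ hy
  have habove : IsNode ν δ A (A y) y' := hA.isNode_above hyy' hy' hAy' hmin
  refine ⟨treeOf hδ hB, ⟨A y, x', y, y', hx, hyy', hnode.2 habove, hnode.2 (hA.isNode hy.le), hmem,
    ?_, ?_⟩, ?_, ?_⟩
  · rintro ⟨a, b⟩ hab ⟨h1, h2⟩
    replace ⟨h1, h3⟩ := Prod.mk_le_mk.1 h1
    replace ⟨h2, h4⟩ := Prod.mk_le_mk.1 h2
    rcases h3.eq_or_lt with rfl | h3
    · rcases h1.eq_or_lt with rfl | h1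
      · exact Or.inr (Or.inl rfl)
      · exact Or.inr (Or.inr (Prod.ext (le_antisymm h2 (hnext a hab h1)) rfl))
    · rcases h1.eq_or_lt with rfl | h1
      · refine Or.inl (Prod.ext rfl (le_antisymm h4 ?_))
        by_contra! h
        exact (hmin b h3 h).not_ge (hnode.1 hab).min_le
      · exact absurd ((hnode.1 hab).compat_below y h3 h1) (h2.trans hx'.le_check).not_gt
  · ext ⟨a, b⟩
    rw [mem_treeOf, Finset.mem_insert, Finset.mem_erase, hnode]
    constructor
    · intro h
      rw [or_iff_not_imp_left]
      intro hne
      have hle : A b ≤ a := by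
        rcases eq_or_ne b y with rfl | hb
        · exact hx.le.trans (hself ▸ h.min_le)
        · exact hother hb ▸ h.min_le
      refine ⟨?_, h.le_top, hle, h.le_check, fun u hu hua => ?_, fun u hu hu' hua => ?_⟩
      · intro heq
        obtain ⟨rfl, rfl⟩ := Prod.mk.inj heq
        exact (hself ▸ h.min_le).not_gt hx
      · rcases eq_or_ne u y with rfl | hu0
        · -- a point of the new tree incompatible with `(A u, u)` can only be `(x', y')`
          by_contra! hac
          have hax : a ≤ x' := by
            by_contra! hlt
            exact (h.compat_below u hu (hself.symm ▸ hlt)).not_ge hac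
          have hnode_a : IsNode ν δ A a u := by
            refine ⟨hy.le, hua.le, hac, fun t ht hta => ?_, fun t ht ht' hta => ?_⟩
            · exact h.compat_below t (ht.trans hu) ((hother ht.ne).symm ▸ hta)
            · exact (hA.compat u t ht ht').resolve_left (hua.trans hta).not_ge
          obtain rfl : a = x' := le_antisymm hax (hnext a (hnode.2 hnode_a) hua)
          refine hne (Prod.ext rfl (le_antisymm ?_ ?_))
          · by_contra! hlt
            have := h.compat_below y' hlt ((hother hyy'.ne').symm ▸ hAy'.trans_lt hx)
            exact (this.trans_le (hac.trans (checkEnd_mono ν δ hyy'.le))).false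
          · by_contra! hlt
            exact ((hA.compat u b hu h.le_top).resolve_left (hmin b hu hlt).not_ge).not_ge
              (hle.trans hac)
        · exact h.compat_below u hu ((hother hu0).symm ▸ hua)
      · rcases eq_or_ne u y with rfl | hu0
        · exact (hA.compat b u hu hu').resolve_left (hle.trans_lt hua).not_ge
        · exact hother hu0 ▸ h.compat_above u hu hu' ((hother hu0).symm ▸ hua)
    · rintro (heq | ⟨hne, h⟩)
      · obtain ⟨rfl, rfl⟩ := Prod.mk.inj heq
        refine ⟨hy', ?_, hx'.le_check.trans (checkEnd_mono ν δ hyy'.le), fun u hu hua => ?_,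
          fun u hu hu' hua => ?_⟩
        · exact (hother hyy'.ne').symm ▸ hAy'.trans hx.le
        · rcases lt_trichotomy u y with h | rfl | h
          · exact hx'.compat_below u h (hother h.ne ▸ hua)
          · rw [hself] at hua
            exact absurd hua (lt_irrefl _)
          · rw [hother h.ne'] at hua
            exact absurd ((hA.compat y u h (hu.le.trans hy')).resolve_left (hmin u h hu).not_ge)
              (hua.le.trans hx'.le_check).not_gt
        · rw [hother (hyy'.trans hu).ne'] at hua ⊢
          exact (hA.compat b u hu hu').resolve_left ((hAy'.trans_lt hx).trans hua).not_ge
      · refine ⟨h.le_top, ?_, h.le_check, fun u hu hua => ?_, fun u hu hu' hua => ?_⟩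
        · rcases eq_or_ne b y with rfl | hb
          · rw [hself]
            exact hnext a (hnode.2 h) (lt_of_le_of_ne h.min_le fun h' => hne (Prod.ext h'.symm rfl))
          · exact (hother hb).symm ▸ h.min_le
        · rcases eq_or_ne u y with rfl | hu0
          · exact T.compat hmem (hnode.2 h) hu (hself ▸ hua)
          · exact h.compat_below u hu (hother hu0 ▸ hua)
        · rcases eq_or_ne u y with rfl | hu0
          · rw [hself] at hua ⊢
            exact T.compat (hnode.2 h) hmem hu hua
          · rw [hother hu0] at hua ⊢
            exact h.compat_above u hu hu' hua
  · rw [rowMin_treeOf hδ hB hy.le, hself]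
  · exact fun u hu hu0 => by rw [rowMin_treeOf hδ hB hu, hother hu0]

/-- Among the rows in which `T'` has a larger minimum than `T`, take those in which the minimum of
`T'` is largest, and among these the lowest row `y`. Then `(rowMin T' y, y)` is also a node of `T`,
so that the rotation at the leftmost node of row `y` does not overshoot `T'`. -/
theorem exists_rotation_le (hδ : ∀ i : Fin n, δ i ≤ ν i.succ) {T T' : AltTamari ν δ}
    (hle : ∀ y ≤ n, rowMin T y ≤ rowMin T' y) (hne : T ≠ T') :
    ∃ T₁, IsRightRotation T T₁ ∧ ∀ y ≤ n, rowMin T₁ y ≤ rowMin T' y := by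
  classical
  have hA := isRowVector_rowMin hδ T
  have hA' := isRowVector_rowMin hδ T'
  set D := (Finset.range (n + 1)).filter fun y => rowMin T y < rowMin T' y with hD
  have hmemD : ∀ {y}, y ∈ D ↔ y ≤ n ∧ rowMin T y < rowMin T' y := by
    intro y
    rw [hD, Finset.mem_filter, Finset.mem_range, Nat.lt_succ_iff]
  have hDne : D.Nonempty := by
    by_contra! h
    refine hne (eq_of_rowMin_eq hδ fun y hy => le_antisymm (hle y hy) ?_)
    by_contra! hlt
    have : y ∈ D := hmemD.2 ⟨hy, hlt⟩
    simp [h] at this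
  obtain ⟨y₀, hy₀, hmax⟩ := D.exists_max_image (rowMin T') hDne
  obtain ⟨y, hy, hmin⟩ := (D.filter fun y => rowMin T' y = rowMin T' y₀).exists_min_image id
    ⟨y₀, Finset.mem_filter.2 ⟨hy₀, rfl⟩⟩
  obtain ⟨hyD, hyw⟩ := Finset.mem_filter.1 hy
  obtain ⟨hyn, hlt⟩ := hmemD.1 hyD
  have hyn' : y < n := by
    refine lt_of_le_of_ne hyn ?_
    rintro rfl
    rw [hA.top, hA'.top] at hlt
    exact lt_irrefl _ hlt
  have hnode : (rowMin T' y, y) ∈ T.1 := by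
    refine (mem_tree_iff hδ T).2 ⟨hyn, hlt.le, hA'.le_check y hyn, fun u hu hux => ?_,
      fun u hu hu' hux => ?_⟩
    · by_contra! hc
      have h1 := (hA'.compat u y hu hyn).resolve_right hc.not_gt
      have huD : u ∈ D := hmemD.2 ⟨hu.le.trans hyn, hux.trans_le h1⟩
      have h2 := hmax u huD
      have := hmin u (Finset.mem_filter.2 ⟨huD, le_antisymm h2 (hyw ▸ h1)⟩)
      exact hu.not_ge this
    · by_contra! hc
      have h1 := hle u hu'
      have h2 := (hA'.compat y u hu hu').resolve_left (hux.trans_le h1).not_ge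
      have := hmax u (hmemD.2 ⟨hu', hc.trans_lt h2⟩)
      rw [← hyw] at this
      exact (hux.trans_le h1).not_ge this
  obtain ⟨x', ⟨hx'T, hx'⟩, hleast⟩ :
      ∃ x', ((x', y) ∈ T.1 ∧ rowMin T y < x') ∧ ∀ a, (a, y) ∈ T.1 → rowMin T y < a → x' ≤ a := by
    have hS : (rowMin T' y, y) ∈ T.1.filter fun p => p.2 = y ∧ rowMin T y < p.1 :=
      Finset.mem_filter.2 ⟨hnode, rfl, hlt⟩
    obtain ⟨⟨a, b⟩, hab, hmin⟩ := Finset.exists_min_image _ Prod.fst ⟨_, hS⟩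
    obtain ⟨haT, hb, h⟩ := Finset.mem_filter.1 hab
    obtain rfl : b = y := hb
    exact ⟨a, ⟨haT, h⟩, fun a' ha' h' => hmin (a', b) (Finset.mem_filter.2 ⟨ha', rfl, h'⟩)⟩
  obtain ⟨T₁, hrot, h1, h2⟩ := exists_rotation hδ T hyn' hx' hx'T hleast
  refine ⟨T₁, hrot, fun u hu => ?_⟩
  rcases eq_or_ne u y with rfl | hu0
  · exact h1.trans_le (hleast _ hnode hlt)
  · exact (h2 u hu hu0).trans_le (hle u hu)

theorem altTamari_le_iff (hδ : ∀ i : Fin n, δ i ≤ ν i.succ) {T T' : AltTamari ν δ} :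
    T ≤ T' ↔ ∀ y ≤ n, rowMin T y ≤ rowMin T' y := by
  constructor
  · intro h y hy
    induction (show Relation.ReflTransGen IsRightRotation T T' from h) with
    | refl => exact le_rfl
    | tail h1 hr ih => exact (ih h1).trans (hr.rowMin_le hδ hy)
  · induction T using WellFoundedGT.induction with
    | _ T ih =>
      intro h
      rcases eq_or_ne T T' with rfl | hne
      · exact le_rfl
      · obtain ⟨T₁, hrot, hle⟩ := exists_rotation_le hδ h hne
        have hT : T ≤ T₁ := Relation.ReflTransGen.single hrot
        have hlt : T < T₁ := hT.lt_of_ne fun heq => by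
          have := hrot.sum_lt
          rw [heq] at this
          exact lt_irrefl _ this
        exact hT.trans (ih T₁ hlt hle)

end Order

/-! ### Joins -/

section Joins

variable {n : ℕ} {ν : Fin (n + 1) → ℕ} {δ : Fin n → ℕ}

theorem isRowVector_hatEnd (hδ : ∀ i : Fin n, δ i ≤ ν i.succ) :
    IsRowVector ν δ (hatEnd ν δ) :=
  ⟨fun _ _ => le_rfl, fun y _ => hatEnd_le_checkEnd hδ y, rfl,
    fun _ _ h _ => Or.inl (hatEnd_anti hδ h.le)⟩

theorem IsRowVector.max {A B : ℕ → ℤ} (hA : IsRowVector ν δ A) (hB : IsRowVector ν δ B) :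
    IsRowVector ν δ fun y => max (A y) (B y) where
  hat_le y hy := le_max_of_le_left (hA.hat_le y hy)
  le_check y hy := max_le (hA.le_check y hy) (hB.le_check y hy)
  top := by rw [hA.top, hB.top, max_self]
  compat y y' h h' := by
    have := hA.compat y y' h h'
    have := hB.compat y y' h h'
    omega

/-- Joins are componentwise maxima of row minima. In particular, each row minimum of a join of a
set of trees is attained by a tree of the set, or is as small as possible. -/
theorem exists_isLUB_rowMin (hδ : ∀ i : Fin n, δ i ≤ ν i.succ) (S : Finset (AltTamari ν δ)) :
    ∃ T, IsLUB (S : Set (AltTamari ν δ)) T ∧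
      ∀ y ≤ n, rowMin T y = hatEnd ν δ y ∨ ∃ s ∈ S, rowMin T y = rowMin s y := by
  classical
  induction S using Finset.induction_on with
  | empty =>
    have h := fun y hy => rowMin_treeOf hδ (isRowVector_hatEnd hδ) (y := y) hy
    refine ⟨treeOf hδ (isRowVector_hatEnd hδ), ⟨by simp, fun T _ => ?_⟩,
      fun y hy => Or.inl (h y hy)⟩
    exact (altTamari_le_iff hδ).2 fun y hy =>
      (h y hy).trans_le ((isRowVector_rowMin hδ T).hat_le y hy)
  | insert s S _ ih =>
    obtain ⟨T, hT, hT'⟩ := ih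
    have hmax := (isRowVector_rowMin hδ s).max (isRowVector_rowMin hδ T)
    have h := fun y hy => rowMin_treeOf hδ hmax (y := y) hy
    refine ⟨treeOf hδ hmax, ?_, fun y hy => ?_⟩
    · rw [Finset.coe_insert]
      refine ⟨?_, fun U hU => ?_⟩
      · rintro U (rfl | hU)
        · exact (altTamari_le_iff hδ).2 fun y hy => (le_max_left _ _).trans_eq (h y hy).symm
        · exact (hT.1 hU).trans
            ((altTamari_le_iff hδ).2 fun y hy => (le_max_right _ _).trans_eq (h y hy).symm)
      · have h1 : s ≤ U := hU (Set.mem_insert _ _)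
        have h2 : T ≤ U := hT.2 fun V hV => hU (Set.mem_insert_of_mem _ hV)
        rw [altTamari_le_iff hδ] at h1 h2 ⊢
        exact fun y hy => (h y hy).trans_le (max_le (h1 y hy) (h2 y hy))
    · rw [h y hy]
      rcases max_choice (rowMin s y) (rowMin T y) with h1 | h1 <;> rw [h1]
      · exact Or.inr ⟨s, Finset.mem_insert_self _ _, rfl⟩
      · rcases hT' y hy with h2 | ⟨t, ht, h2⟩
        · exact Or.inl h2
        · exact Or.inr ⟨t, Finset.mem_insert_of_mem ht, h2⟩

theorem rowMin_of_isLUB (hδ : ∀ i : Fin n, δ i ≤ ν i.succ) {S : Finset (AltTamari ν δ)}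
    {T : AltTamari ν δ} (hT : IsLUB (S : Set (AltTamari ν δ)) T) {y : ℕ} (hy : y ≤ n) :
    rowMin T y = hatEnd ν δ y ∨ ∃ s ∈ S, rowMin T y = rowMin s y := by
  obtain ⟨T', h1, h2⟩ := exists_isLUB_rowMin hδ S
  exact hT.unique h1 ▸ h2 y hy

theorem isLatticeOrder_altTamari (hδ : ∀ i : Fin n, δ i ≤ ν i.succ) :
    IsLatticeOrder (AltTamari ν δ) := by
  classical
  intro T T'
  refine ⟨?_, ?_⟩
  · obtain ⟨U, hU, -⟩ := exists_isLUB_rowMin hδ {T, T'}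
    exact ⟨U, by simpa using hU⟩
  · -- the meet is the join of all common lower bounds
    have hfin := Set.toFinite (lowerBounds {T, T'})
    obtain ⟨U, hU, -⟩ := exists_isLUB_rowMin hδ hfin.toFinset
    rw [Set.Finite.coe_toFinset, isLUB_lowerBounds] at hU
    exact ⟨U, hU⟩

end Joins

/-! ### Vertex decomposability of independence complexes -/

section Independence

variable {α β : Type*}

/-- The complex of independent sets of the graph that `G` induces on `S`. -/
def independenceComplex (G : SimpleGraph α) (S : Finset α) : LowerSet (Finset α) where
  carrier := {I | I ⊆ S ∧ ∀ a ∈ I, ∀ b ∈ I, ¬ G.Adj a b}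
  lower' := fun _ _ hle h => ⟨hle.trans h.1, fun a ha b hb => h.2 a (hle ha) b (hle hb)⟩

theorem mem_independenceComplex {G : SimpleGraph α} {S I : Finset α} :
    I ∈ independenceComplex G S ↔ I ⊆ S ∧ ∀ a ∈ I, ∀ b ∈ I, ¬ G.Adj a b :=
  Iff.rfl

open scoped Classical in
/-- The graph that `G` induces on `S` can be dismantled: it has no edges, or it has a vertex `v`
whose closed neighborhood contains the closed neighborhood of some neighbor `w` of `v`, such that
the graphs obtained by removing `v` together with its neighbors, or `v` alone, can be
dismantled. -/
inductive Dismantlable (G : SimpleGraph α) : Finset α → Prop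
  | edgeless (S : Finset α) (h : ∀ a ∈ S, ∀ b ∈ S, ¬ G.Adj a b) : Dismantlable G S
  | shed (S : Finset α) (v w : α) (hv : v ∈ S) (hw : w ∈ S) (hvw : G.Adj v w)
      (hdom : ∀ x ∈ S, G.Adj w x → x = v ∨ G.Adj v x)
      (hlink : Dismantlable G (S.filter fun x => x ≠ v ∧ ¬ G.Adj v x))
      (hdel : Dismantlable G (S.erase v)) : Dismantlable G S

theorem complexLink_independenceComplex [DecidableEq α] {G : SimpleGraph α}
    [DecidableRel G.Adj] {S : Finset α} {v : α} (hv : v ∈ S) :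
    complexLink (independenceComplex G S) {v} =
      independenceComplex G (S.filter fun x => x ≠ v ∧ ¬ G.Adj v x) := by
  ext F
  change (F ∈ independenceComplex G S ∧ Disjoint F {v} ∧ _ ∈ independenceComplex G S) ↔ _
  simp only [Finset.disjoint_singleton_right, SetLike.mem_coe]
  constructor
  · rintro ⟨h1, h2, h3⟩
    refine ⟨fun x hx => Finset.mem_filter.2 ⟨h1.1 hx, fun h => h2 (h ▸ hx), ?_⟩, h1.2⟩
    exact h3.2 v (by simp) x (by simp [hx])
  · rintro ⟨h1, h2⟩
    have h3 := fun x hx => Finset.mem_filter.1 (h1 (x := x) hx)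
    refine ⟨⟨fun x hx => (h3 x hx).1, h2⟩, fun h => (h3 v h).2.1 rfl, fun x hx => ?_,
      fun a ha b hb => ?_⟩
    · simp only [Finset.mem_union, Finset.mem_singleton] at hx
      rcases hx with hx | rfl
      · exact (h3 x hx).1
      · exact hv
    · simp only [Finset.mem_union, Finset.mem_singleton] at ha hb
      rcases ha with ha | rfl <;> rcases hb with hb | rfl
      · exact h2 a ha b hb
      · exact fun h => (h3 a ha).2.2 h.symm
      · exact (h3 b hb).2.2
      · exact G.loopless.irrefl _

theorem complexDeletion_independenceComplex [DecidableEq α] {G : SimpleGraph α} {S : Finset α}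
    {v : α} :
    complexDeletion (independenceComplex G S) {v} = independenceComplex G (S.erase v) := by
  ext F
  change (F ∈ independenceComplex G S ∧ ¬ {v} ⊆ F) ↔ _
  simp only [Finset.singleton_subset_iff, SetLike.mem_coe, mem_independenceComplex,
    Finset.subset_erase]
  tauto

/-- In a dismantling step the vertex `v` is a shedding vertex, because each face of its link can be
extended by `w` in the deletion. -/
theorem Dismantlable.vertexDecomposable {G : SimpleGraph α} {S : Finset α}
    (h : Dismantlable G S) : VertexDecomposable (independenceComplex G S) := by
  classical
  induction h with
  | edgeless S h =>
    have : independenceComplex G S = LowerSet.Iic S := by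
      ext F
      exact ⟨fun hF => hF.1, fun hF => ⟨hF, fun a ha b hb => h a (hF ha) b (hF hb)⟩⟩
    exact this ▸ VertexDecomposable.simplex S
  | shed S v w hv hw hvw hdom _ _ ihlink ihdel =>
    refine VertexDecomposable.decompose _ v ⟨by simpa using hv, by simp⟩ ?_ ?_ ?_
    · convert ihlink
      exact complexLink_independenceComplex hv
    · convert ihdel
      exact complexDeletion_independenceComplex
    · rw [complexLink_independenceComplex hv, complexDeletion_independenceComplex]
      intro F hF hF'
      have hF₀ : F ∈ independenceComplex G _ := hF.prop
      have h1 := fun x (hx : x ∈ F) => Finset.mem_filter.1 (hF₀.1 hx)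
      have hwF : w ∉ F := fun h => (h1 w h).2.2 hvw
      have hno : ∀ x ∈ F, ¬ G.Adj w x := fun x hx hwx =>
        (hdom x (h1 x hx).1 hwx).elim (h1 x hx).2.1 (h1 x hx).2.2
      have hins : insert w F ∈ independenceComplex G (S.erase v) := by
        refine ⟨Finset.insert_subset (Finset.mem_erase.2 ⟨hvw.ne', hw⟩) hF'.prop.1, ?_⟩
        intro a ha b hb
        rcases Finset.mem_insert.1 ha with rfl | haF <;>
          rcases Finset.mem_insert.1 hb with rfl | hbF
        · exact G.loopless.irrefl _
        · exact hno b hbF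
        · exact fun h => hno a haF h.symm
        · exact hF.prop.2 a haF b hbF
      exact hwF (hF'.le_of_ge hins (Finset.subset_insert _ _) (Finset.mem_insert_self _ _))

open scoped Classical in
theorem Dismantlable.shed_union {G : SimpleGraph α} {S U : Finset α} {v w : α} (hv : v ∈ S)
    (hw : w ∈ S) (hvw : G.Adj v w) (hdom : ∀ x ∈ S, G.Adj w x → x = v ∨ G.Adj v x)
    (hd : Disjoint S U) (hno : ∀ a ∈ S, ∀ b ∈ U, ¬ G.Adj a b)
    (hlink : Dismantlable G ((S.filter fun x => x ≠ v ∧ ¬ G.Adj v x) ∪ U))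
    (hdel : Dismantlable G (S.erase v ∪ U)) : Dismantlable G (S ∪ U) := by
  have hvU : v ∉ U := Finset.disjoint_left.1 hd hv
  refine Dismantlable.shed _ v w (Finset.mem_union_left _ hv) (Finset.mem_union_left _ hw) hvw ?_
    ?_ ?_
  · intro x hx hwx
    rcases Finset.mem_union.1 hx with hx | hx
    · exact hdom x hx hwx
    · exact absurd hwx (hno w hw x hx)
  · convert hlink using 1
    rw [Finset.filter_union, Finset.filter_true_of_mem (s := U)]
    exact fun x hx => ⟨fun h => hvU (h ▸ hx), hno v hv x hx⟩
  · rwa [Finset.erase_union_distrib, Finset.erase_eq_of_notMem hvU]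

open scoped Classical in
/-- A disjoint union of dismantlable graphs is dismantlable; its independence complex is the join of
their independence complexes. -/
theorem Dismantlable.union [d : DecidableEq α] {G : SimpleGraph α} {S U : Finset α}
    (hS : Dismantlable G S) (hU : Dismantlable G U) (hd : Disjoint S U)
    (hno : ∀ a ∈ S, ∀ b ∈ U, ¬ G.Adj a b) : Dismantlable G (S ∪ U) := by
  obtain rfl : d = fun _ _ => Classical.propDecidable _ := Subsingleton.elim _ _
  induction hS with
  | edgeless S h =>
    induction hU with
    | edgeless U h' =>
      refine Dismantlable.edgeless _ fun a ha b hb => ?_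
      rcases Finset.mem_union.1 ha with ha | ha <;> rcases Finset.mem_union.1 hb with hb | hb
      · exact h a ha b hb
      · exact hno a ha b hb
      · exact fun hab => hno b hb a ha hab.symm
      · exact h' a ha b hb
    | shed U v w hv hw hvw hdom _ _ ihlink ihdel =>
      rw [Finset.union_comm]
      refine Dismantlable.shed_union hv hw hvw hdom hd.symm
        (fun a ha b hb hab => hno b hb a ha hab.symm) ?_ ?_
      · rw [Finset.union_comm]
        exact ihlink (Finset.disjoint_of_subset_right (Finset.filter_subset _ _) hd)
          fun a ha b hb => hno a ha b (Finset.filter_subset _ _ hb)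
      · rw [Finset.union_comm]
        exact ihdel (Finset.disjoint_of_subset_right (Finset.erase_subset _ _) hd)
          fun a ha b hb => hno a ha b (Finset.erase_subset _ _ hb)
  | shed S v w hv hw hvw hdom _ _ ihlink ihdel =>
    refine Dismantlable.shed_union hv hw hvw hdom hd hno ?_ ?_
    · exact ihlink (Finset.disjoint_of_subset_left (Finset.filter_subset _ _) hd)
        fun a ha b hb => hno a (Finset.filter_subset _ _ ha) b hb
    · exact ihdel (Finset.disjoint_of_subset_left (Finset.erase_subset _ _) hd)
        fun a ha b hb => hno a (Finset.erase_subset _ _ ha) b hb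

open scoped Classical in
theorem Dismantlable.image_comap {G : SimpleGraph α} {S : Finset α} (hS : Dismantlable G S)
    {f : α → β} {g : β → α} (hgf : ∀ s ∈ S, g (f s) = s) :
    Dismantlable (G.comap g) (S.image f) := by
  induction hS with
  | edgeless S h =>
    refine Dismantlable.edgeless _ fun a ha b hb => ?_
    obtain ⟨a, haS, rfl⟩ := Finset.mem_image.1 ha
    obtain ⟨b, hbS, rfl⟩ := Finset.mem_image.1 hb
    rw [SimpleGraph.comap_adj, hgf a haS, hgf b hbS]
    exact h a haS b hbS
  | shed S v w hv hw hvw hdom _ _ ihlink ihdel =>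
    have hinj : ∀ x ∈ S, f x = f v → x = v := fun x hx h => by rw [← hgf x hx, h, hgf v hv]
    refine Dismantlable.shed _ (f v) (f w) (Finset.mem_image_of_mem f hv)
      (Finset.mem_image_of_mem f hw) ?_ ?_ ?_ ?_
    · rwa [SimpleGraph.comap_adj, hgf v hv, hgf w hw]
    · intro x hxS
      obtain ⟨x, hx, rfl⟩ := Finset.mem_image.1 hxS
      rw [SimpleGraph.comap_adj, SimpleGraph.comap_adj, hgf v hv, hgf w hw, hgf x hx]
      exact fun h => (hdom x hx h).imp (congrArg f) id
    · convert ihlink fun s hs => hgf s (Finset.filter_subset _ _ hs) using 1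
      ext b
      simp only [Finset.mem_filter, Finset.mem_image, SimpleGraph.comap_adj]
      constructor
      · rintro ⟨⟨x, hx, rfl⟩, h1, h2⟩
        rw [hgf v hv, hgf x hx] at h2
        exact ⟨x, ⟨hx, fun h => h1 (h ▸ rfl), h2⟩, rfl⟩
      · rintro ⟨x, ⟨hx, h1, h2⟩, rfl⟩
        refine ⟨⟨x, hx, rfl⟩, fun h => h1 (hinj x hx h), ?_⟩
        rwa [hgf v hv, hgf x hx]
    · convert ihdel fun s hs => hgf s (Finset.erase_subset _ _ hs) using 1
      ext b
      simp only [Finset.mem_erase, Finset.mem_image]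
      constructor
      · rintro ⟨h1, x, hx, rfl⟩
        exact ⟨x, ⟨fun h => h1 (h ▸ rfl), hx⟩, rfl⟩
      · rintro ⟨x, ⟨h1, hx⟩, rfl⟩
        exact ⟨fun h => h1 (hinj x hx h), x, hx, rfl⟩

end Independence

/-! ### The conflict graph of a diagram -/

section Diagram

/-- Two distinct points are adjacent if one is weakly southwest of the other and the southeast
corner of the rectangle that they span lies weakly to the left of the boundary `x = c y`. -/
def conflictGraph (c : ℕ → ℤ) : SimpleGraph (ℤ × ℕ) where
  Adj p q := p ≠ q ∧ ((p ≤ q ∧ q.1 ≤ c p.2) ∨ (q ≤ p ∧ p.1 ≤ c q.2))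
  symm := ⟨fun _ _ h => ⟨h.1.symm, h.2.symm⟩⟩
  loopless := ⟨fun _ h => h.1 rfl⟩

theorem conflictGraph_adj {c : ℕ → ℤ} {x x' : ℤ} {y y' : ℕ} :
    (conflictGraph c).Adj (x, y) (x', y') ↔ ¬ (x = x' ∧ y = y') ∧
      ((x ≤ x' ∧ y ≤ y' ∧ x' ≤ c y) ∨ (x' ≤ x ∧ y' ≤ y ∧ x ≤ c y')) := by
  simp only [conflictGraph, ne_eq, Prod.mk.injEq, Prod.mk_le_mk, and_assoc]

/-- The points `(x, y)` with `h y < x ≤ c y` in the columns `X` and the rows `Y`. -/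
def diagram (h c : ℕ → ℤ) (X : Finset ℤ) (Y : Finset ℕ) : Finset (ℤ × ℕ) :=
  (X ×ˢ Y).filter fun p => h p.2 < p.1 ∧ p.1 ≤ c p.2

theorem mem_diagram {h c : ℕ → ℤ} {X : Finset ℤ} {Y : Finset ℕ} {x : ℤ} {y : ℕ} :
    (x, y) ∈ diagram h c X Y ↔ x ∈ X ∧ y ∈ Y ∧ h y < x ∧ x ≤ c y := by
  simp only [diagram, Finset.mem_filter, Finset.mem_product, and_assoc]

variable {h c : ℕ → ℤ} {X : Finset ℤ} {Y : Finset ℕ} {x₀ : ℤ} {y₀ : ℕ}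

/-- The column `x₀` can be shed point by point if all its points are adjacent to a point `(x₀, y₀)`
below all other rows which has no further neighbors. The remaining points not adjacent to `(x₀, y)`
are those to its southeast and those to its northwest or beyond the boundary of row `y`; these two
parts do not interact. -/
theorem dismantlable_column (hc : Monotone c) (hY : ∀ y ∈ Y, y₀ < y)
    (hx₀ : h y₀ < x₀) (hx₀c : x₀ ≤ c y₀) (hmax : ∀ x ∈ X, x ≤ c y₀ → x ≤ x₀)
    (hsub : ∀ Y' ⊆ Y, ∀ X, Dismantlable (conflictGraph c) (diagram h c X Y'))
    {K : Finset ℕ} (hK : K ⊆ Y) :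
    Dismantlable (conflictGraph c)
      (diagram h c (X.erase x₀) Y ∪ {(x₀, y₀)} ∪ K.image fun y => (x₀, y)) := by
  classical
  induction K using Finset.induction_on with
  | empty =>
    rw [Finset.image_empty, Finset.union_empty]
    refine (hsub Y Finset.Subset.rfl _).union (Dismantlable.edgeless _ ?_) ?_ ?_
    · simp
    · rw [Finset.disjoint_singleton_right, mem_diagram]
      exact fun h => lt_irrefl _ (hY _ h.2.1)
    · rintro ⟨a, b⟩ hab _ hq
      obtain rfl := Finset.mem_singleton.1 hq
      rw [mem_diagram, Finset.mem_erase] at hab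
      rw [conflictGraph_adj]
      have := hY b hab.2.1
      have := hmax a hab.1.2
      omega
  | insert y K hyK ih =>
    rw [Finset.insert_subset_iff] at hK
    have hy := hY y hK.1
    have hcy := hc hy.le
    refine Dismantlable.shed _ (x₀, y) (x₀, y₀) (by simp) (by simp) ?_ ?_ ?_ ?_
    · rw [conflictGraph_adj]
      omega
    · rintro ⟨a, b⟩ hab
      simp only [Finset.mem_union, mem_diagram, Finset.mem_erase, Finset.mem_singleton,
        Finset.mem_image, Finset.mem_insert, Prod.mk.injEq] at hab
      rw [conflictGraph_adj, conflictGraph_adj, Prod.mk.injEq]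
      rcases hab with (hab | hab) | ⟨b, hb, rfl, rfl⟩
      · have := hY b hab.2.1
        have := hmax a hab.1.2
        omega
      · omega
      · have : y₀ < b := hb.elim (fun h => h ▸ hy) fun h => hY b (hK.2 h)
        have := hc this.le
        omega
    · have hd := (hsub (Y.filter fun b => b < y) (Finset.filter_subset _ _)
        (X.filter fun a => x₀ < a)).union (hsub (Y.filter fun b => y < b)
        (Finset.filter_subset _ _) (X.filter fun a => ¬ (x₀ ≤ a ∧ a ≤ c y))) ?_ ?_
      · convert hd using 1
        ext ⟨a, b⟩
        simp only [Finset.mem_filter, Finset.mem_union, mem_diagram, Finset.mem_erase,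
          Finset.mem_singleton, Finset.mem_image, Finset.mem_insert, Prod.mk.injEq,
          conflictGraph_adj, ne_eq]
        constructor
        · rintro ⟨(hab | hab) | ⟨b, hb, rfl, rfl⟩, h1, h2⟩
          · have := hY b hab.2.1
            have := hc this.le
            rcases lt_trichotomy b y with hby | rfl | hby
            · left
              refine ⟨⟨hab.1.2, ?_⟩, ⟨hab.2.1, hby⟩, hab.2.2⟩
              omega
            · omega
            · right
              refine ⟨⟨hab.1.2, ?_⟩, ⟨hab.2.1, hby⟩, hab.2.2⟩
              omega
          · obtain ⟨rfl, rfl⟩ := hab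
            omega
          · have : y₀ < b := hb.elim (fun h => h ▸ hy) fun h => hY b (hK.2 h)
            have := hc this.le
            omega
        · rintro (⟨h1, h2, h3⟩ | ⟨h1, h2, h3⟩)
          · refine ⟨Or.inl (Or.inl ⟨⟨by omega, h1.1⟩, h2.1, h3⟩), ?_, ?_⟩ <;> omega
          · have := hc h2.2.le
            refine ⟨Or.inl (Or.inl ⟨⟨by omega, h1.1⟩, h2.1, h3⟩), ?_, ?_⟩ <;> omega
      · rw [Finset.disjoint_left]
        rintro ⟨a, b⟩ h1 h2
        simp only [mem_diagram, Finset.mem_filter] at h1 h2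
        omega
      · rintro ⟨a, b⟩ h1 ⟨a', b'⟩ h2
        simp only [mem_diagram, Finset.mem_filter] at h1 h2
        rw [conflictGraph_adj]
        have := hc h1.2.1.2.le
        omega
    · convert ih hK.2 using 1
      ext ⟨a, b⟩
      simp only [Finset.mem_union, mem_diagram, Finset.mem_erase, Finset.mem_singleton,
        Finset.mem_image, Finset.mem_insert, Prod.mk.injEq, ne_eq]
      constructor
      · rintro ⟨h1, (hab | hab) | ⟨b, rfl | hb, rfl, rfl⟩⟩
        · exact Or.inl (Or.inl hab)
        · exact Or.inl (Or.inr hab)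
        · exact absurd ⟨rfl, rfl⟩ h1
        · exact Or.inr ⟨b, hb, rfl, rfl⟩
      · rintro ((hab | hab) | ⟨b, hb, rfl, rfl⟩)
        · exact ⟨fun h => hab.1.1 h.1, Or.inl (Or.inl hab)⟩
        · exact ⟨by omega, Or.inl (Or.inr hab)⟩
        · exact ⟨fun h => hyK (h.2 ▸ hb), Or.inr ⟨b, Or.inr hb, rfl, rfl⟩⟩

/-- The points to the left of the rightmost point `(x₀, y₀)` of the lowest row `y₀` can be shed one
by one: each is adjacent to all neighbors of `(x₀, y₀)`, and its link is again a diagram. -/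
theorem dismantlable_row (hh : Antitone h) (hc : Monotone c) (hY : ∀ y ∈ Y, y₀ < y)
    (hx₀X : x₀ ∈ X) (hx₀ : h y₀ < x₀) (hx₀c : x₀ ≤ c y₀) (hmax : ∀ x ∈ X, x ≤ c y₀ → x ≤ x₀)
    (hsub : ∀ Y' ⊆ Y, ∀ X, Dismantlable (conflictGraph c) (diagram h c X Y'))
    {R : Finset ℤ} (hR : ∀ x ∈ R, x < x₀) :
    Dismantlable (conflictGraph c)
      (diagram h c X Y ∪ {(x₀, y₀)} ∪ R.image fun x => (x, y₀)) := by
  classical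
  induction R using Finset.induction_on with
  | empty =>
    convert dismantlable_column hc hY hx₀ hx₀c hmax hsub Finset.Subset.rfl using 1
    ext ⟨a, b⟩
    simp only [Finset.mem_union, mem_diagram, Finset.mem_erase, Finset.mem_singleton,
      Finset.mem_image, Finset.notMem_empty, false_and, exists_false, or_false, Prod.mk.injEq]
    constructor
    · rintro (hab | hab)
      · rcases eq_or_ne a x₀ with rfl | ha
        · exact Or.inr ⟨b, hab.2.1, rfl, rfl⟩
        · exact Or.inl (Or.inl ⟨⟨ha, hab.1⟩, hab.2⟩)
      · exact Or.inl (Or.inr hab)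
    · rintro ((hab | hab) | ⟨b, hb, rfl, rfl⟩)
      · exact Or.inl ⟨hab.1.2, hab.2⟩
      · exact Or.inr hab
      · have h1 := hh (hY b hb).le
        have h2 := hc (hY b hb).le
        exact Or.inl ⟨hx₀X, hb, h1.trans_lt hx₀, hx₀c.trans h2⟩
  | insert x R hxR ih =>
    have hx := hR x (Finset.mem_insert_self _ _)
    have hR' : ∀ x ∈ R, x < x₀ := fun x hx => hR x (Finset.mem_insert_of_mem hx)
    refine Dismantlable.shed _ (x, y₀) (x₀, y₀) (by simp) (by simp) ?_ ?_ ?_ ?_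
    · rw [conflictGraph_adj]
      omega
    · rintro ⟨a, b⟩ hab
      simp only [Finset.mem_union, mem_diagram, Finset.mem_singleton, Finset.mem_image,
        Prod.mk.injEq] at hab
      rw [conflictGraph_adj, conflictGraph_adj, Prod.mk.injEq]
      rcases hab with (hab | hab) | ⟨a, ha, rfl, rfl⟩
      · have := hY b hab.2.1
        omega
      · omega
      · have := hR a ha
        omega
    · convert hsub Y Finset.Subset.rfl (X.filter fun a => ¬ (x ≤ a ∧ a ≤ x₀)) using 1
      ext ⟨a, b⟩
      simp only [Finset.mem_filter, Finset.mem_union, mem_diagram, Finset.mem_singleton,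
        Finset.mem_image, Prod.mk.injEq, conflictGraph_adj, ne_eq]
      constructor
      · rintro ⟨(hab | hab) | ⟨a, ha, rfl, rfl⟩, h1, h2⟩
        · have := hY b hab.2.1
          refine ⟨⟨hab.1, ?_⟩, hab.2⟩
          omega
        · omega
        · have := hR a ha
          omega
      · rintro ⟨h1, h2, h3⟩
        have := hY b h2
        have := hmax a h1.1
        refine ⟨Or.inl (Or.inl ⟨h1.1, h2, h3⟩), ?_, ?_⟩ <;> omega
    · convert ih hR' using 1
      ext ⟨a, b⟩
      simp only [Finset.mem_union, mem_diagram, Finset.mem_erase, Finset.mem_singleton,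
        Finset.mem_image, Finset.mem_insert, Prod.mk.injEq, ne_eq]
      constructor
      · rintro ⟨h1, (hab | hab) | ⟨b, rfl | hb, rfl, rfl⟩⟩
        · exact Or.inl (Or.inl hab)
        · exact Or.inl (Or.inr hab)
        · exact absurd ⟨rfl, rfl⟩ h1
        · exact Or.inr ⟨_, hb, rfl, rfl⟩
      · rintro ((hab | hab) | ⟨a, ha, rfl, rfl⟩)
        · exact ⟨fun h => (hY b hab.2.1).ne' h.2, Or.inl (Or.inl hab)⟩
        · exact ⟨by omega, Or.inl (Or.inr hab)⟩
        · exact ⟨fun h => hxR (h.1 ▸ ha), Or.inr ⟨_, Or.inr ha, rfl, rfl⟩⟩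

theorem dismantlable_diagram (hh : Antitone h) (hc : Monotone c) (X : Finset ℤ) (Y : Finset ℕ) :
    Dismantlable (conflictGraph c) (diagram h c X Y) := by
  classical
  induction Y using Finset.strongInduction generalizing X with
  | H Y ih =>
    rcases Y.eq_empty_or_nonempty with rfl | hne
    · exact Dismantlable.edgeless _ (by simp [diagram])
    set y₀ := Y.min' hne with hy₀
    have hy₀Y : y₀ ∈ Y := Y.min'_mem hne
    have hY : ∀ y ∈ Y.erase y₀, y₀ < y := fun y hy => Y.min'_lt_of_mem_erase_min' hne hy
    have hsub : ∀ Y' ⊆ Y.erase y₀, ∀ X, Dismantlable (conflictGraph c) (diagram h c X Y') :=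
      fun Y' hY' X => ih Y' (hY'.trans_ssubset (Finset.erase_ssubset hy₀Y)) X
    rcases (X.filter fun x => h y₀ < x ∧ x ≤ c y₀).eq_empty_or_nonempty with hR | hR
    · convert hsub _ Finset.Subset.rfl X using 1
      ext ⟨a, b⟩
      rw [mem_diagram, mem_diagram, Finset.mem_erase]
      refine ⟨fun hab => ⟨hab.1, ⟨?_, hab.2.1⟩, hab.2.2⟩, fun hab => ⟨hab.1, hab.2.1.2, hab.2.2⟩⟩
      rintro rfl
      exact Finset.notMem_empty a (hR ▸ Finset.mem_filter.2 ⟨hab.1, hab.2.2⟩)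
    · set R := X.filter fun x => h y₀ < x ∧ x ≤ c y₀ with hRdef
      obtain ⟨hx₀X, hx₀, hx₀c⟩ := Finset.mem_filter.1 (R.max'_mem hR)
      set x₀ := R.max' hR with hx₀def
      have hmax : ∀ x ∈ X, x ≤ c y₀ → x ≤ x₀ := by
        intro x hx hxc
        by_contra! hlt
        exact hlt.not_ge (R.le_max' x (Finset.mem_filter.2 ⟨hx, hx₀.trans hlt, hxc⟩))
      convert dismantlable_row hh hc hY hx₀X hx₀ hx₀c hmax hsub (R := R.erase x₀)
        (fun x hx => R.lt_max'_of_mem_erase_max' hR hx) using 1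
      ext ⟨a, b⟩
      simp only [Finset.mem_union, mem_diagram, Finset.mem_erase, Finset.mem_singleton,
        Finset.mem_image, Prod.mk.injEq, hRdef, Finset.mem_filter]
      constructor
      · intro hab
        rcases eq_or_ne b y₀ with rfl | hb
        · rcases eq_or_ne a x₀ with rfl | ha
          · exact Or.inl (Or.inr ⟨rfl, rfl⟩)
          · exact Or.inr ⟨a, ⟨ha, hab.1, hab.2.2⟩, rfl, rfl⟩
        · exact Or.inl (Or.inl ⟨hab.1, ⟨hb, hab.2.1⟩, hab.2.2⟩)
      · rintro ((hab | ⟨rfl, rfl⟩) | ⟨a, ha, rfl, rfl⟩)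
        · exact ⟨hab.1, hab.2.1.2, hab.2.2⟩
        · exact ⟨hx₀X, hy₀Y, hx₀, hx₀c⟩
        · exact ⟨ha.2.1, hy₀Y, ha.2.2⟩

end Diagram

/-! ### Join-irreducible trees -/

section JoinIrreducible

variable {n : ℕ} {ν : Fin (n + 1) → ℕ} {δ : Fin n → ℕ}

/-- For `y < n` and `h y < x ≤ c y`, where `h = hatEnd ν δ` and `c = checkEnd ν δ`, this is the
smallest row vector with the value `x` in row `y`: compatibility forces the value up to `x` in those
lower rows that extend to column `x`. -/
def irrVector (ν : Fin (n + 1) → ℕ) (δ : Fin n → ℕ) (x : ℤ) (y u : ℕ) : ℤ :=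
  if u ≤ y ∧ x ≤ checkEnd ν δ u then max (hatEnd ν δ u) x else hatEnd ν δ u

theorem isRowVector_irrVector (hδ : ∀ i : Fin n, δ i ≤ ν i.succ) (x : ℤ) {y : ℕ} (hy : y < n) :
    IsRowVector ν δ (irrVector ν δ x y) := by
  have hhc := hatEnd_le_checkEnd (ν := ν) hδ
  refine ⟨fun u _ => ?_, fun u _ => ?_, ?_, fun u u' hu _ => ?_⟩
  · unfold irrVector
    split_ifs <;> omega
  · have := hhc u
    unfold irrVector
    split_ifs <;> omega
  · unfold irrVector
    split_ifs <;> omega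
  · have := hatEnd_anti hδ hu.le
    unfold irrVector
    split_ifs <;> omega

/-- The tree whose row minima are `irrVector ν δ x y`. -/
noncomputable def irrTree (hδ : ∀ i : Fin n, δ i ≤ ν i.succ) (x : ℤ) {y : ℕ} (hy : y < n) :
    AltTamari ν δ :=
  treeOf hδ (isRowVector_irrVector hδ x hy)

/-- The points `(x, y)` that label join-irreducible trees. -/
def IsLabel (ν : Fin (n + 1) → ℕ) (δ : Fin n → ℕ) (x : ℤ) (y : ℕ) : Prop :=
  y < n ∧ hatEnd ν δ y < x ∧ x ≤ checkEnd ν δ y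

theorem rowMin_irrTree (hδ : ∀ i : Fin n, δ i ≤ ν i.succ) (x : ℤ) {y u : ℕ} (hy : y < n)
    (hu : u ≤ n) : rowMin (irrTree (ν := ν) hδ x hy) u = irrVector ν δ x y u :=
  rowMin_treeOf hδ _ hu

theorem rowMin_irrTree_self (hδ : ∀ i : Fin n, δ i ≤ ν i.succ) {x : ℤ} {y : ℕ}
    (h : IsLabel ν δ x y) : rowMin (irrTree (ν := ν) hδ x h.1) y = x := by
  rw [rowMin_irrTree hδ x h.1 h.1.le, irrVector, if_pos ⟨le_rfl, h.2.2⟩, max_eq_right h.2.1.le]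

theorem irrTree_le (hδ : ∀ i : Fin n, δ i ≤ ν i.succ) {T : AltTamari ν δ} {y : ℕ} (hy : y < n) :
    irrTree hδ (rowMin T y) hy ≤ T := by
  rw [altTamari_le_iff hδ]
  intro u hu
  have hT := isRowVector_rowMin hδ T
  rw [rowMin_irrTree hδ _ hy hu, irrVector]
  split_ifs with h
  · refine max_le (hT.hat_le u hu) ?_
    rcases h.1.eq_or_lt with rfl | hlt
    · exact le_rfl
    · exact (hT.compat u y hlt hy.le).resolve_right h.2.not_gt
  · exact hT.hat_le u hu

/-- The row minimum of `irrTree x' y'` in row `y` reaches `x` only if `(x, y)` is weakly southwest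
of `(x', y')` and `x'` does not exceed the boundary of row `y`. -/
theorem conflict_of_le_rowMin (hδ : ∀ i : Fin n, δ i ≤ ν i.succ) {x x' : ℤ} {y y' : ℕ}
    (h : IsLabel ν δ x y) (h' : y' < n) (hle : x ≤ rowMin (irrTree (ν := ν) hδ x' h') y) :
    x ≤ x' ∧ y ≤ y' ∧ x' ≤ checkEnd ν δ y := by
  have := h.2.1
  rw [rowMin_irrTree hδ x' h' h.1.le, irrVector] at hle
  split_ifs at hle <;> omega

theorem IsLabel.of_rowMin (hδ : ∀ i : Fin n, δ i ≤ ν i.succ) {T : AltTamari ν δ} {y : ℕ}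
    (hy : y ≤ n) (h : hatEnd ν δ y ≠ rowMin T y) : IsLabel ν δ (rowMin T y) y := by
  have hT := isRowVector_rowMin hδ T
  refine ⟨lt_of_le_of_ne hy ?_, lt_of_le_of_ne (hT.hat_le y hy) h, hT.le_check y hy⟩
  rintro rfl
  exact h hT.top.symm

/-- The trees strictly below `irrTree x y` are those with a smaller minimum in row `y`, so they are
closed under joins. -/
theorem isJoinIrreducible_irrTree (hδ : ∀ i : Fin n, δ i ≤ ν i.succ) {x : ℤ} {y : ℕ}
    (h : IsLabel ν δ x y) : IsJoinIrreducible (irrTree (ν := ν) hδ x h.1) := by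
  classical
  set J := irrTree (ν := ν) hδ x h.1 with hJ
  have hself : rowMin J y = x := rowMin_irrTree_self hδ h
  have hlt : ∀ T < J, rowMin T y < x := by
    intro T hT
    refine lt_of_le_of_ne (hself ▸ (altTamari_le_iff hδ).1 hT.le y h.1.le) fun heq => ?_
    have h1 := irrTree_le hδ (T := T) h.1
    rw [heq] at h1
    exact hT.not_ge h1
  obtain ⟨I, hI, hI'⟩ := exists_isLUB_rowMin hδ (Set.toFinite (Set.Iio J)).toFinset
  rw [Set.Finite.coe_toFinset] at hI
  have hIJ : I < J := by
    refine lt_of_le_of_ne (hI.2 fun T hT => le_of_lt hT) ?_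
    rintro rfl
    rcases hI' y h.1.le with h1 | ⟨T, hT, h1⟩
    · exact h.2.1.ne' (hself.symm.trans h1)
    · exact (hlt T (by simpa using hT)).ne (h1 ▸ hself)
  refine ⟨I, ⟨hIJ, fun T hT hTJ => (hI.1 hTJ).not_gt hT⟩, fun T hT => ?_⟩
  exact (hI.1 hT.lt).eq_of_not_lt fun hTI => hT.2 hTI hIJ

end JoinIrreducible

/-! ### The canonical join complex -/

section CanonicalJoin

variable {n : ℕ} {ν : Fin (n + 1) → ℕ} {δ : Fin n → ℕ}

theorem IsCanonicalJoinRepresentation.unique {L : Type*} [PartialOrder L] {A B : Finset L} {a : L}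
    (hA : IsCanonicalJoinRepresentation A a) (hB : IsCanonicalJoinRepresentation B a) : A = B := by
  have key : ∀ {A B : Finset L}, IsCanonicalJoinRepresentation A a →
      IsCanonicalJoinRepresentation B a → A ⊆ B := by
    intro A B hA hB x hx
    obtain ⟨y, hy, hxy⟩ := hA.2.2 B hB.1 x hx
    obtain ⟨z, hz, hyz⟩ := hB.2.2 A hA.1 y hy
    obtain rfl : x = z := hA.2.1.eq hx hz (hxy.trans hyz)
    exact le_antisymm hxy hyz ▸ hy
  exact (key hA hB).antisymm (key hB hA)

/-- The set of labels of join-irreducible trees. -/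
noncomputable def labels (ν : Fin (n + 1) → ℕ) (δ : Fin n → ℕ) : Finset (ℤ × ℕ) :=
  diagram (hatEnd ν δ) (checkEnd ν δ) (Finset.Icc 0 (checkEnd ν δ n)) (Finset.range n)

theorem mem_labels (hδ : ∀ i : Fin n, δ i ≤ ν i.succ) {x : ℤ} {y : ℕ} :
    (x, y) ∈ labels ν δ ↔ IsLabel ν δ x y := by
  rw [labels, mem_diagram, Finset.mem_range, Finset.mem_Icc, IsLabel]
  refine ⟨fun h => h.2, fun h => ⟨⟨?_, ?_⟩, h⟩⟩
  · have := hatEnd_anti hδ h.1.le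
    rw [hatEnd_top] at this
    exact this.trans h.2.1.le
  · exact h.2.2.trans (checkEnd_mono ν δ h.1.le)

open scoped Classical in
/-- The join-irreducible tree with label `p`; junk value for points that are not labels. -/
noncomputable def labelTree (hδ : ∀ i : Fin n, δ i ≤ ν i.succ) (p : ℤ × ℕ) : AltTamari ν δ :=
  if h : p.2 < n then irrTree hδ p.1 h else treeOf hδ (isRowVector_hatEnd hδ)

theorem labelTree_eq (hδ : ∀ i : Fin n, δ i ≤ ν i.succ) {x : ℤ} {y : ℕ} (h : IsLabel ν δ x y) :
    labelTree (ν := ν) hδ (x, y) = irrTree hδ x h.1 :=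
  dif_pos h.1

theorem le_rowMin_labelTree (hδ : ∀ i : Fin n, δ i ≤ ν i.succ) {p q : ℤ × ℕ}
    (hp : p ∈ labels ν δ) (hq : q ∈ labels ν δ)
    (hle : p.1 ≤ rowMin (labelTree (ν := ν) hδ q) p.2) :
    p ≤ q ∧ (p = q ∨ (conflictGraph (checkEnd ν δ)).Adj p q) := by
  obtain ⟨x, y⟩ := p
  obtain ⟨x', y'⟩ := q
  rw [mem_labels hδ] at hp hq
  rw [labelTree_eq hδ hq] at hle
  have := conflict_of_le_rowMin hδ hp hq.1 hle
  rw [conflictGraph_adj, Prod.mk.injEq, Prod.mk_le_mk]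
  tauto

theorem rowMin_labelTree_self (hδ : ∀ i : Fin n, δ i ≤ ν i.succ) {p : ℤ × ℕ}
    (hp : p ∈ labels ν δ) : rowMin (labelTree (ν := ν) hδ p) p.2 = p.1 := by
  rw [labelTree_eq hδ ((mem_labels hδ).1 hp), rowMin_irrTree_self hδ ((mem_labels hδ).1 hp)]

theorem injOn_labelTree (hδ : ∀ i : Fin n, δ i ≤ ν i.succ) :
    Set.InjOn (labelTree (ν := ν) hδ) (labels ν δ) := by
  intro p hp q hq heq
  refine le_antisymm (le_rowMin_labelTree hδ hp hq ?_).1 (le_rowMin_labelTree hδ hq hp ?_).1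
  · rw [← heq, rowMin_labelTree_self hδ hp]
  · rw [heq, rowMin_labelTree_self hδ hq]

theorem labelTree_le (hδ : ∀ i : Fin n, δ i ≤ ν i.succ) {p : ℤ × ℕ} (hp : p ∈ labels ν δ)
    {T : AltTamari ν δ} (hT : rowMin T p.2 = p.1) : labelTree hδ p ≤ T := by
  obtain ⟨x, y⟩ := p
  rw [labelTree_eq hδ ((mem_labels hδ).1 hp)]
  obtain rfl : rowMin T y = x := hT
  exact irrTree_le hδ _

open scoped Classical in
/-- The join-irreducible trees of an independent set of labels form a canonical join representation
of their join `T`: independence means that each label `(x, y)` satisfies `rowMin T y = x`, and since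
joins are componentwise maxima, each join representation of `T` has a member with minimum `x` in
row `y`. -/
theorem isCanonicalJoinRepresentation_image (hδ : ∀ i : Fin n, δ i ≤ ν i.succ)
    {I : Finset (ℤ × ℕ)} (hI : I ∈ independenceComplex (conflictGraph (checkEnd ν δ)) (labels ν δ))
    {T : AltTamari ν δ} (hT : IsLUB (I.image (labelTree hδ) : Set (AltTamari ν δ)) T) :
    IsCanonicalJoinRepresentation (I.image (labelTree hδ)) T := by
  have heq : ∀ p ∈ I, ∀ q ∈ I, p.1 ≤ rowMin (labelTree (ν := ν) hδ q) p.2 → p = q :=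
    fun p hp q hq h => (le_rowMin_labelTree hδ (hI.1 hp) (hI.1 hq) h).2.resolve_right
      (hI.2 p hp q hq)
  have hmem : ∀ p ∈ I, labelTree (ν := ν) hδ p ∈ I.image (labelTree hδ) := fun p hp =>
    Finset.mem_image_of_mem _ hp
  refine ⟨⟨fun J hJ => ?_, hT⟩, ?_, fun B hB J hJ => ?_⟩
  · obtain ⟨p, hp, rfl⟩ := Finset.mem_image.1 hJ
    have hlab := (mem_labels hδ).1 (hI.1 hp)
    rw [labelTree_eq hδ hlab]
    exact isJoinIrreducible_irrTree hδ hlab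
  · intro J hJ J' hJ' hne hle
    obtain ⟨p, hp, rfl⟩ := Finset.mem_image.1 (Finset.mem_coe.1 hJ)
    obtain ⟨q, hq, rfl⟩ := Finset.mem_image.1 (Finset.mem_coe.1 hJ')
    have hpn := ((mem_labels hδ).1 (hI.1 hp)).1.le
    refine hne (congrArg _ (heq p hp q hq ?_))
    rw [← rowMin_labelTree_self hδ (hI.1 hp)]
    exact (altTamari_le_iff hδ).1 hle _ hpn
  · obtain ⟨p, hp, rfl⟩ := Finset.mem_image.1 hJ
    have hlab := (mem_labels hδ).1 (hI.1 hp)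
    have hpn := hlab.1.le
    have hTp : rowMin T p.2 = p.1 := by
      have hge : p.1 ≤ rowMin T p.2 := by
        rw [← rowMin_labelTree_self hδ (hI.1 hp)]
        exact (altTamari_le_iff hδ).1 (hT.1 (hmem p hp)) _ hpn
      rcases rowMin_of_isLUB hδ hT hpn with h | ⟨J', hJ', h⟩
      · exact absurd (hlab.2.1.trans_le hge) (h ▸ lt_irrefl _)
      · obtain ⟨q, hq, rfl⟩ := Finset.mem_image.1 hJ'
        obtain rfl := heq p hp q hq (h ▸ hge)
        rw [h, rowMin_labelTree_self hδ (hI.1 hp)]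
    rcases rowMin_of_isLUB hδ hB.2 hpn with h | ⟨J', hJ', h⟩
    · exact absurd (hlab.2.1.trans_eq hTp.symm) (h ▸ lt_irrefl _)
    · exact ⟨J', hJ', labelTree_le hδ (hI.1 hp) (h ▸ hTp)⟩

open scoped Classical in
/-- For each value of the row minima of `T` take the highest row with this value. The resulting
labels are independent, and the join of their trees is `T`. -/
theorem exists_independent_isLUB (hδ : ∀ i : Fin n, δ i ≤ ν i.succ) (T : AltTamari ν δ) :
    ∃ I ∈ independenceComplex (conflictGraph (checkEnd ν δ)) (labels ν δ),
      IsLUB (I.image (labelTree hδ) : Set (AltTamari ν δ)) T := by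
  have hT := isRowVector_rowMin hδ T
  refine ⟨(labels ν δ).filter fun p => rowMin T p.2 = p.1 ∧ ∀ u < n, p.2 < u → rowMin T u ≠ p.1,
    ⟨Finset.filter_subset _ _, ?_⟩, ?_, ?_⟩
  · rintro ⟨x, y⟩ hp ⟨x', y'⟩ hq hadj
    obtain ⟨hp, h1, h2⟩ := Finset.mem_filter.1 hp
    obtain ⟨hq, h3, h4⟩ := Finset.mem_filter.1 hq
    rw [mem_labels hδ] at hp hq
    have key : ∀ {a b : ℤ} {u v : ℕ}, rowMin T u = a → rowMin T v = b → v < n →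
        (∀ t < n, u < t → rowMin T t ≠ a) → ¬ (a = b ∧ u = v) →
        ¬ (a ≤ b ∧ u ≤ v ∧ b ≤ checkEnd ν δ u) := by
      rintro a b u v rfl rfl hv hmax hne ⟨h5, h6, h7⟩
      have huv : u < v := h6.lt_of_ne fun h => hne ⟨h ▸ rfl, h⟩
      have h8 := (hT.compat u v huv hv.le).resolve_right h7.not_gt
      exact hmax v hv huv (le_antisymm h8 h5)
    obtain ⟨hne, h5 | h5⟩ := conflictGraph_adj.1 hadj
    · exact key h1 h3 hq.1 h2 hne h5
    · exact key h3 h1 hp.1 h4 (fun h => hne ⟨h.1.symm, h.2.symm⟩) h5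
  · intro J hJ
    obtain ⟨p, hp, rfl⟩ := Finset.mem_image.1 (Finset.mem_coe.1 hJ)
    obtain ⟨hp, h1, -⟩ := Finset.mem_filter.1 hp
    exact labelTree_le hδ hp h1
  · intro U hU
    rw [altTamari_le_iff hδ]
    intro y hy
    by_cases heq : hatEnd ν δ y = rowMin T y
    · exact heq ▸ (isRowVector_rowMin hδ U).hat_le y hy
    have hlab := IsLabel.of_rowMin hδ hy heq
    obtain ⟨z, hz, hzmax⟩ := Finset.exists_max_image
      ((Finset.range n).filter fun u => y ≤ u ∧ rowMin T u = rowMin T y) id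
      ⟨y, Finset.mem_filter.2 ⟨Finset.mem_range.2 hlab.1, le_rfl, rfl⟩⟩
    obtain ⟨hzn, hyz, hzy⟩ := Finset.mem_filter.1 hz
    have hzn := Finset.mem_range.1 hzn
    have hlabz : IsLabel ν δ (rowMin T z) z := IsLabel.of_rowMin hδ hzn.le
      ((hatEnd_anti hδ hyz).trans_lt (hzy.symm ▸ hlab.2.1)).ne
    have hmem : labelTree hδ (rowMin T z, z) ≤ U := by
      refine hU (Finset.mem_coe.2 (Finset.mem_image_of_mem _ (Finset.mem_filter.2
        ⟨(mem_labels hδ).2 hlabz, rfl, fun u hu hzu hut => ?_⟩)))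
      exact hzu.not_ge (hzmax u (Finset.mem_filter.2
        ⟨Finset.mem_range.2 hu, hyz.trans (le_of_lt hzu), hut.trans hzy⟩))
    rw [labelTree_eq hδ hlabz] at hmem
    refine le_trans ?_ ((altTamari_le_iff hδ).1 hmem y hy)
    rw [rowMin_irrTree hδ _ _ hy, irrVector, hzy, if_pos ⟨hyz, hlab.2.2⟩]
    exact le_max_right _ _

open scoped Classical in
theorem exists_canonicalJoinRepresentation (hδ : ∀ i : Fin n, δ i ≤ ν i.succ)
    (T : AltTamari ν δ) :
    ∃ I ∈ independenceComplex (conflictGraph (checkEnd ν δ)) (labels ν δ),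
      IsCanonicalJoinRepresentation (I.image (labelTree hδ)) T := by
  obtain ⟨I, hI, hT⟩ := exists_independent_isLUB hδ T
  exact ⟨I, hI, isCanonicalJoinRepresentation_image hδ hI hT⟩

open scoped Classical in
/-- The canonical join complex is the flag complex of pairs of join-irreducible trees with
non-adjacent labels. -/
theorem canonicalJoinComplex_eq (hδ : ∀ i : Fin n, δ i ≤ ν i.succ)
    (hL : IsLatticeOrder (AltTamari ν δ)) {g : AltTamari ν δ → ℤ × ℕ}
    (hg : ∀ p ∈ labels ν δ, g (labelTree hδ p) = p) :
    canonicalJoinComplex hL =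
      independenceComplex ((conflictGraph (checkEnd ν δ)).comap g)
        ((labels ν δ).image (labelTree hδ)) := by
  ext F
  constructor
  · rintro ⟨T, hT⟩
    obtain ⟨I, hI, hI'⟩ := exists_canonicalJoinRepresentation hδ T
    rw [hT.unique hI']
    refine ⟨Finset.image_subset_image hI.1, fun a ha b hb => ?_⟩
    obtain ⟨p, hp, rfl⟩ := Finset.mem_image.1 ha
    obtain ⟨q, hq, rfl⟩ := Finset.mem_image.1 hb
    rw [SimpleGraph.comap_adj, hg p (hI.1 hp), hg q (hI.1 hq)]
    exact hI.2 p hp q hq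
  · rintro ⟨h1, h2⟩
    obtain ⟨I, hI, rfl⟩ := Finset.subset_image_iff.1 h1
    obtain ⟨T, hT, -⟩ := exists_isLUB_rowMin hδ (I.image (labelTree hδ))
    refine ⟨T, isCanonicalJoinRepresentation_image hδ ⟨hI, fun p hp q hq => ?_⟩ hT⟩
    have := h2 _ (Finset.mem_image_of_mem _ hp) _ (Finset.mem_image_of_mem _ hq)
    rwa [SimpleGraph.comap_adj, hg p (hI hp), hg q (hI hq)] at this

end CanonicalJoin

theorem theorem1p2 {n : ℕ} (ν : Fin (n + 1) → ℕ) (δ : Fin n → ℕ)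
    (hδ : ∀ i : Fin n, δ i ≤ ν i.succ) :
    ∃ hL : IsLatticeOrder (AltTamari ν δ),
      (∀ T : AltTamari ν δ, ∃ A : Finset (AltTamari ν δ), IsCanonicalJoinRepresentation A T) ∧
      VertexDecomposable (canonicalJoinComplex hL) := by
  classical
  refine ⟨isLatticeOrder_altTamari hδ, fun T => ?_, ?_⟩
  · obtain ⟨I, -, hI⟩ := exists_canonicalJoinRepresentation hδ T
    exact ⟨_, hI⟩
  · have hg := fun p hp => (injOn_labelTree hδ).leftInvOn_invFunOn (x := p) hp
    rw [canonicalJoinComplex_eq hδ _ hg]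
    exact ((dismantlable_diagram (hatEnd_anti hδ) (checkEnd_mono ν δ) _ _).image_comap
      hg).vertexDecomposable
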